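/- Theorem. Assume the Strong Exponential Time Hypothesis (SETH): for every $\delta>0$ there is an integer $d$ such that $d$-SAT (satisfiability of CNF formulas with at most $d$ literals per clause) cannot be solved in time $O^*((2-\delta)^n)$, where $n$ is the number of variables and $O^*$ suppresses factors polynomial in the input size. Let $\varepsilon>0$ be a real number. In Steiner Tree the input consists of a finite simple graph $G=(V,E)$, a set $T\subseteq V$ of terminals and an integer $k\ge 0$, and the question is whether there is a set $S\subseteq V$ with $T\subseteq S$ and $|S|\le k$ such that the induced subgraph $G[S]$ is connected (and nonempty). A linear arrangement of $G$ is a bijection $\ell:\{1,\dots,|V|\}\to V$; its cutwidth $\mathrm{ctw}(\ell)$ is the maximum over $i$ of the number of edges $\{\ell(j),\ell(m)\}\in E$ with $j\le i<m$ (and $0$ if $V$ is empty), and the cutwidth $\mathrm{ctw}(G)$ is the minimum of $\mathrm{ctw}(\ell)$ over all linear arrangements $\ell$ of $G$. Then no algorithm solves Steiner Tree in time $O^*((3-\varepsilon)^{\mathrm{ctw}(G)})$. This remains true when a linear arrangement is given: no algorithm that receives $(G,T,k)$ together with a linear arrangement $\ell$ of $G$ solves Steiner Tree in time $O^*((3-\varepsilon)^{\mathrm{ctw}(\ell)})$.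 Algorithms are deterministic programs of a random access machine with logarithmic cost, both in SETH and in the conclusion. -/

import Mathlib

namespace SteinerCutwidth

/-! ### Random access machines with logarithmic cost -/

/-- A machine state: registers holding natural numbers, and arrays of natural numbers with
unbounded index range. A fixed program mentions only finitely many registers and arrays. -/
structure State where
  reg : ℕ → ℕ
  arr : ℕ → ℕ → ℕ

namespace State

/-- `x := v`. -/
def setReg (s : State) (x v : ℕ) : State :=
  { s with reg := Function.update s.reg x v }

/-- `a[i] := v`. -/
def setArr (s : State) (a i v : ℕ) : State :=
  { s with arr := Function.update s.arr a (Function.update (s.arr a) i v) }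

end State

/-- Binary arithmetic instructions of the machine. -/
inductive ArithOp
  | add
  | sub
  | mul
  | div

/-- Arithmetic on natural numbers (truncated subtraction, integer division). -/
def ArithOp.eval : ArithOp → ℕ → ℕ → ℕ
  | .add, a, b => a + b
  | .sub, a, b => a - b
  | .mul, a, b => a * b
  | .div, a, b => a / b

/-- Programs of the random access machine. -/
inductive Prog
  /-- `x := c` for a constant `c` -/
  | const (x c : ℕ)
  /-- `x := y op z` for registers `x`, `y`, `z` -/
  | arith (op : ArithOp) (x y z : ℕ)
  /-- `x := a[y]`, the array `a` read at the address held by register `y` -/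
  | load (x a y : ℕ)
  /-- `a[y] := z`, the array `a` written at the address held by register `y` -/
  | store (a y z : ℕ)
  /-- `p; q` -/
  | seq (p q : Prog)
  /-- `if x ≠ 0 then p else q` -/
  | cond (x : ℕ) (p q : Prog)
  /-- `while x ≠ 0 do p` -/
  | loop (x : ℕ) (p : Prog)

/-- `Run p s s' t`: the program `p`, started in state `s`, halts in state `s'` after time `t`.
Every instruction and every test is charged the logarithmic cost: one plus the binary lengths of
the constants, operands and addresses that it handles. -/
inductive Run : Prog → State → State → ℕ → Prop
  | const (s : State) (x c : ℕ) :
      Run (.const x c) s (s.setReg x c) (1 + Nat.size c)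
  | arith (s : State) (op : ArithOp) (x y z : ℕ) :
      Run (.arith op x y z) s (s.setReg x (op.eval (s.reg y) (s.reg z)))
        (1 + Nat.size (s.reg y) + Nat.size (s.reg z))
  | load (s : State) (x a y : ℕ) :
      Run (.load x a y) s (s.setReg x (s.arr a (s.reg y)))
        (1 + Nat.size (s.reg y) + Nat.size (s.arr a (s.reg y)))
  | store (s : State) (a y z : ℕ) :
      Run (.store a y z) s (s.setArr a (s.reg y) (s.reg z))
        (1 + Nat.size (s.reg y) + Nat.size (s.reg z))
  | seq {p q : Prog} {s s' s'' : State} {t t' : ℕ} (hp : Run p s s' t) (hq : Run q s' s'' t') :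
      Run (.seq p q) s s'' (t + t')
  | cond_true {x : ℕ} {p q : Prog} {s s' : State} {t : ℕ} (hx : s.reg x ≠ 0)
      (hp : Run p s s' t) : Run (.cond x p q) s s' (1 + Nat.size (s.reg x) + t)
  | cond_false {x : ℕ} {p q : Prog} {s s' : State} {t : ℕ} (hx : s.reg x = 0)
      (hq : Run q s s' t) : Run (.cond x p q) s s' (1 + Nat.size (s.reg x) + t)
  | loop_done {x : ℕ} {p : Prog} {s : State} (hx : s.reg x = 0) :
      Run (.loop x p) s s (1 + Nat.size (s.reg x))
  | loop_step {x : ℕ} {p : Prog} {s s' s'' : State} {t t' : ℕ} (hx : s.reg x ≠ 0)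
      (hp : Run p s s' t) (hl : Run (.loop x p) s' s'' t') :
      Run (.loop x p) s s'' (1 + Nat.size (s.reg x) + t + t')

/-- The initial state on an input word: the input stands in array `0`, all other cells and all
registers are zero. -/
def initState (w : List ℕ) : State where
  reg := fun _ => 0
  arr := fun a i => if a = 0 then w.getD i 0 else 0

/-- A decision problem: its instances, its yes-instances, and the encoding of instances as finite
sequences of natural numbers. -/
structure DecisionProblem where
  Instance : Type
  Yes : Instance → Prop
  encode : Instance → List ℕ

/-- The size of an encoded instance: its length in binary, with one separator per number. -/
def inputSize (w : List ℕ) : ℕ :=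
  (w.map fun a => Nat.size a + 1).sum

/-- The problem `P` can be solved in time `O*(f)`: some program halts on every instance `x` with
the correct answer (register `0` is nonzero exactly on yes-instances) after time at most
`C * |x| ^ c * f x`, for constants `C` and `c`. -/
def SolvableInTimeOStar (P : DecisionProblem) (f : P.Instance → ℝ) : Prop :=
  ∃ (p : Prog) (C c : ℕ), ∀ x : P.Instance, ∃ (s : State) (t : ℕ),
    Run p (initState (P.encode x)) s t ∧ (s.reg 0 ≠ 0 ↔ P.Yes x) ∧
      (t : ℝ) ≤ (C : ℝ) * (inputSize (P.encode x) : ℝ) ^ c * f x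

/-! ### `d`-SAT and the Strong Exponential Time Hypothesis -/

/-- A CNF formula over the variables `0, …, numVars - 1` with at most `d` literals per clause.
The literal `(v, true)` is the variable `v` and `(v, false)` is its negation. -/
structure CNF (d : ℕ) where
  numVars : ℕ
  clauses : List (List (Fin numVars × Bool))
  width_le : ∀ c ∈ clauses, c.length ≤ d

/-- Some truth assignment makes some literal of every clause true. -/
def CNF.Satisfiable {d : ℕ} (φ : CNF d) : Prop :=
  ∃ a : Fin φ.numVars → Bool, ∀ c ∈ φ.clauses, ∃ l ∈ c, a l.1 = l.2

/-- The number of variables, the number of clauses, and then every clause as its length followed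
by its literals, where `2 * v + 1` stands for the variable `v` and `2 * v` for its negation. -/
def CNF.encode {d : ℕ} (φ : CNF d) : List ℕ :=
  φ.numVars :: φ.clauses.length ::
    φ.clauses.flatMap fun c => c.length :: c.map fun l => 2 * (l.1 : ℕ) + l.2.toNat

/-- The problem `d`-SAT. -/
def dSAT (d : ℕ) : DecisionProblem where
  Instance := CNF d
  Yes := CNF.Satisfiable
  encode := CNF.encode

/-- The Strong Exponential Time Hypothesis: for every `δ > 0` there is a `d` such that `d`-SAT
cannot be solved in time `O*((2 - δ) ^ n)`, where `n` is the number of variables. -/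
def SETH : Prop :=
  ∀ δ : ℝ, 0 < δ → ∃ d : ℕ,
    ¬ SolvableInTimeOStar (dSAT d) (fun φ : CNF d => (2 - δ) ^ φ.numVars)

/-! ### Cutwidth -/

/-- The cut of the linear arrangement `ℓ` after position `i`: the edges of `G` with one end at a
position `≤ i` and the other one at a position `> i`. -/
def cut {V : Type*} {n : ℕ} (G : SimpleGraph V) (ℓ : Fin n ≃ V) (i : Fin n) : Set (Sym2 V) :=
  {e | e ∈ G.edgeSet ∧ ∃ j k : Fin n, j ≤ i ∧ i < k ∧ e = s(ℓ j, ℓ k)}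

/-- The cutwidth of the linear arrangement `ℓ` of `G`: the maximum size of its cuts. -/
noncomputable def arrangementCutwidth {V : Type*} {n : ℕ} (G : SimpleGraph V) (ℓ : Fin n ≃ V) : ℕ :=
  Finset.univ.sup fun i : Fin n => (cut G ℓ i).ncard

/-- The cutwidth of a graph: the minimum cutwidth of its linear arrangements. -/
noncomputable def cutwidth {n : ℕ} (G : SimpleGraph (Fin n)) : ℕ :=
  ⨅ ℓ : Fin n ≃ Fin n, arrangementCutwidth G ℓ

/-! ### Steiner Tree -/

/-- An instance of Steiner Tree: a graph, a set of terminals, and a budget. -/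
structure STInstance where
  n : ℕ
  graph : SimpleGraph (Fin n)
  terminals : Finset (Fin n)
  budget : ℕ

/-- There is a set of at most `budget` vertices that contains all terminals and induces a
connected subgraph. -/
def STInstance.HasSteinerTree (I : STInstance) : Prop :=
  ∃ S : Finset (Fin I.n), S.card ≤ I.budget ∧ I.terminals ⊆ S ∧
    (I.graph.induce (S : Set (Fin I.n))).Connected

open Classical in
/-- The number of vertices, the budget, the indicator vector of the terminals, and the adjacency
matrix row by row. -/
noncomputable def STInstance.encode (I : STInstance) : List ℕ :=
  I.n :: I.budget ::
    ((List.finRange I.n).map (fun v => if v ∈ I.terminals then 1 else 0) ++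
      (List.finRange I.n).flatMap fun u =>
        (List.finRange I.n).map fun v => if I.graph.Adj u v then 1 else 0)

/-- An instance of Steiner Tree together with a linear arrangement of its graph, which maps
positions to vertices. -/
structure ArrangedSTInstance extends STInstance where
  arrangement : Fin n ≃ Fin n

/-- The encoded Steiner Tree instance followed by the vertices in the order of the arrangement. -/
noncomputable def ArrangedSTInstance.encode (I : ArrangedSTInstance) : List ℕ :=
  I.toSTInstance.encode ++ (List.finRange I.n).map fun i => (I.arrangement i : ℕ)

/-- Steiner Tree. -/
noncomputable def steinerTree : DecisionProblem where
  Instance := STInstance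
  Yes := STInstance.HasSteinerTree
  encode := STInstance.encode

/-- Steiner Tree with a linear arrangement of the graph given in the input. -/
noncomputable def arrangedSteinerTree : DecisionProblem where
  Instance := ArrangedSTInstance
  Yes := fun I => I.toSTInstance.HasSteinerTree
  encode := ArrangedSTInstance.encode

end SteinerCutwidth

/-! The reduction from `d`-SAT splits the variables into blocks of `t₀` and writes an assignment of
a block as a word of length `t` over three letters. The gadget graph has a row of cells for each
block and a column for each clause, plus one last column. In each cell a solution selects one vertex
`z α`, and consecutive cells of a row are linked by `t` track edges from `b i` to `a i`. The letter
tells how a track is joined to the roots: through its right end `a i` for 0, through its left end `b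
i` for 2, and for 1 neither end is selected. A track edge thus carries three states, and a cut with
about `G * t` edges can transport about `3 ^ (G * t)` assignments.

The budget leaves exactly one selected vertex per class (`IsSolution.injOn_cls`). Connectivity then
yields inclusions only: letters 0 persist to the right and letters 2 persist to the left
(`IsSolution.z_next`). Among words with equal numbers of 0s and of 2s the inclusions are equalities,
and restricting to such words costs only a factor `(t + 1) ^ 2` (`exists_separated`). Hence a row
carries a single assignment, and the clause vertex of a column, adjacent to the `z α` that satisfy
the clause, tests it (`IsSolution.exists_hit`). The converse is `exists_isSolution`.

Listing the cells column by column gives width `G * t` up to a constant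
(`arrangementCutwidth_inst_le`). For `ρ < 3` there are `t`, `t₀` with `ρ ^ t < 2 ^ t₀`
(`exists_blocks`), and the gap also absorbs the polynomial factors (`solvable_dSAT`).

On the machine, each entry of the output word is the value of one fixed arithmetic expression
(`Expr.out`), so the reduction consists of two array-filling loops (`exists_run_reduction`), after
which the assumed algorithm runs on fresh registers and arrays (`exists_run_of_reduction`). -/

namespace SteinerCutwidth

/-! ### Expressions and their compilation -/

/-- Arithmetic expressions in a loop index and in the contents of the arrays. -/
inductive Expr
  | idx
  | const (c : ℕ)
  | op (o : ArithOp) (e f : Expr)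
  | read (a : ℕ) (e : Expr)

namespace Expr

/-- The value of an expression for the array contents `A` and the loop index `x`. -/
def eval (A : ℕ → ℕ → ℕ) (x : ℕ) : Expr → ℕ
  | idx => x
  | const c => c
  | op o e f => o.eval (e.eval A x) (f.eval A x)
  | read a e => A a (e.eval A x)

/-- A program that writes the value of the expression to register `d`, the loop index being held
by register `0`. -/
def compile : Expr → ℕ → Prog
  | idx, d => .seq (.const d 0) (.arith .add d 0 d)
  | const c, d => .const d c
  | op o e f, d => .seq (e.compile d) (.seq (f.compile (d + 1)) (.arith o d d (d + 1)))
  | read a e, d => .seq (e.compile d) (.load d a d)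

/-- The number of registers used by the compiled expression. -/
def width : Expr → ℕ
  | idx => 1
  | const _ => 1
  | op _ e f => e.width + f.width + 1
  | read _ e => e.width

/-- A factor that bounds the length of the values of the expression. -/
def bits : Expr → ℕ
  | idx => 1
  | const c => Nat.size c
  | op _ e f => e.bits + f.bits + 1
  | read _ _ => 1

/-- A factor that bounds the running time of the compiled expression. -/
def cost : Expr → ℕ
  | idx => 2
  | const c => 1 + Nat.size c
  | op _ e f => e.cost + f.cost + (1 + e.bits + f.bits)
  | read _ e => e.cost + (2 + e.bits)

end Expr

theorem ArithOp.size_eval_le (o : ArithOp) (a b : ℕ) :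
    Nat.size (o.eval a b) ≤ Nat.size a + Nat.size b + 1 := by
  have ha := Nat.lt_size_self a
  have hb := Nat.lt_size_self b
  cases o
  · simp only [ArithOp.eval]
    rw [Nat.size_le]
    calc a + b < 2 ^ a.size + 2 ^ b.size := by omega
      _ ≤ 2 ^ (a.size + b.size) + 2 ^ (a.size + b.size) := by
        exact Nat.add_le_add (Nat.pow_le_pow_right (by norm_num) (by omega))
          (Nat.pow_le_pow_right (by norm_num) (by omega))
      _ = 2 ^ (a.size + b.size + 1) := by ring
  · exact (Nat.size_le_size (Nat.sub_le a b)).trans (by omega)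
  · simp only [ArithOp.eval]
    rw [Nat.size_le]
    calc a * b < 2 ^ a.size * 2 ^ b.size := by
          apply Nat.mul_lt_mul'' ha hb
      _ = 2 ^ (a.size + b.size) := by ring
      _ ≤ 2 ^ (a.size + b.size + 1) := Nat.pow_le_pow_right (by norm_num) (by omega)
  · exact (Nat.size_le_size (Nat.div_le_self a b)).trans (by omega)

/-- Lengths at most add up, with one extra bit, under each operation, so a fixed expression has
values of length linear in `L`. A read starts afresh because all cells are bounded by `hA`. -/
theorem Expr.size_eval_le {A : ℕ → ℕ → ℕ} {x L : ℕ} (hA : ∀ a i, Nat.size (A a i) ≤ L)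
    (hx : Nat.size x ≤ L) (e : Expr) : Nat.size (e.eval A x) ≤ e.bits * (L + 1) := by
  induction e with
  | idx => simp only [Expr.eval, Expr.bits]; omega
  | const c => simp only [Expr.eval, Expr.bits]; nlinarith [Nat.zero_le (Nat.size c * L)]
  | op o e f he hf =>
    have := ArithOp.size_eval_le o (e.eval A x) (f.eval A x)
    simp only [Expr.eval, Expr.bits]
    nlinarith
  | read a e he => simp only [Expr.eval, Expr.bits]; have := hA a (e.eval A x); omega

/-- Registers are used as a stack from `d` upwards: the second operand is computed from `d + 1` on,
so the first one survives in `d`. The condition `0 < d` protects the loop index in register `0`. -/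
theorem Expr.exists_run_compile {L : ℕ} (e : Expr) : ∀ (d : ℕ) (s : State), 0 < d →
    (∀ a i, Nat.size (s.arr a i) ≤ L) → Nat.size (s.reg 0) ≤ L →
    ∃ s' t, Run (e.compile d) s s' t ∧ s'.arr = s.arr ∧ s'.reg d = e.eval s.arr (s.reg 0) ∧
      (∀ y, y < d ∨ d + e.width ≤ y → s'.reg y = s.reg y) ∧ t ≤ e.cost * (L + 1) := by
  induction e with
  | idx =>
    intro d s hd hA hx
    refine ⟨_, _, .seq (.const s d 0) (.arith _ .add d 0 d), rfl, ?_, ?_, ?_⟩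
    · simp [State.setReg, ArithOp.eval, Expr.eval, Function.update, hd.ne]
    · intro y hy
      have : y ≠ d := by simp only [Expr.width] at hy; omega
      simp [State.setReg, Function.update, this]
    · simp [State.setReg, Function.update, hd.ne, Expr.cost]; omega
  | const c =>
    intro d s hd hA hx
    refine ⟨_, _, .const s d c, rfl, ?_, ?_, ?_⟩
    · simp [State.setReg, Expr.eval]
    · intro y hy
      have : y ≠ d := by simp only [Expr.width] at hy; omega
      simp [State.setReg, Function.update, this]
    · simp only [Expr.cost]; nlinarith [Nat.zero_le ((1 + Nat.size c) * L)]
  | op o e f he hf =>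
    intro d s hd hA hx
    obtain ⟨s₁, t₁, r₁, a₁, v₁, u₁, b₁⟩ := he d s hd hA hx
    have h0 : s₁.reg 0 = s.reg 0 := u₁ 0 (Or.inl hd)
    obtain ⟨s₂, t₂, r₂, a₂, v₂, u₂, b₂⟩ := hf (d + 1) s₁ (by omega) (a₁ ▸ hA) (h0 ▸ hx)
    have hd2 : s₂.reg d = e.eval s.arr (s.reg 0) := by rw [u₂ d (Or.inl (by omega)), v₁]
    rw [a₁, h0] at v₂
    refine ⟨_, _, .seq r₁ (.seq r₂ (.arith s₂ o d d (d + 1))), ?_, ?_, ?_, ?_⟩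
    · simp [State.setReg, a₂, a₁]
    · simp [State.setReg, Expr.eval, hd2, v₂]
    · intro y hy
      simp only [Expr.width] at hy
      have : y ≠ d := by omega
      simp only [State.setReg, Function.update, this]
      simp only [dite_false]
      rw [u₂ y (by omega), u₁ y (by omega)]
    · have he' := Expr.size_eval_le hA hx e
      have hf' := Expr.size_eval_le hA hx f
      rw [hd2, v₂]
      simp only [Expr.cost]
      nlinarith
  | read a e he =>
    intro d s hd hA hx
    obtain ⟨s₁, t₁, r₁, a₁, v₁, u₁, b₁⟩ := he d s hd hA hx
    refine ⟨_, _, .seq r₁ (.load s₁ d a d), ?_, ?_, ?_, ?_⟩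
    · simp [State.setReg, a₁]
    · simp [State.setReg, Expr.eval, v₁, a₁]
    · intro y hy
      simp only [Expr.width] at hy
      have hw : 0 < e.width := by
        clear * -
        induction e <;> simp only [Expr.width] <;> omega
      have : y ≠ d := by omega
      simp only [State.setReg, Function.update, this]
      simp only [dite_false]
      exact u₁ y hy
    · have he' := Expr.size_eval_le hA hx e
      have := hA a (e.eval s.arr (s.reg 0))
      rw [v₁, a₁]
      simp only [Expr.cost]
      nlinarith

/-! ### Filling an array -/

/-- The array contents `A` after `F 0, …, F (x - 1)` were written to the array `a`. -/
def fill (A : ℕ → ℕ → ℕ) (a : ℕ) (F : ℕ → ℕ) (x : ℕ) : ℕ → ℕ → ℕ :=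
  Function.update A a fun i => if i < x then F i else A a i

theorem fill_zero (A : ℕ → ℕ → ℕ) (a : ℕ) (F : ℕ → ℕ) : fill A a F 0 = A := by
  simp [fill]

theorem fill_succ (A : ℕ → ℕ → ℕ) (a : ℕ) (F : ℕ → ℕ) (x : ℕ) :
    Function.update (fill A a F x) a (Function.update (fill A a F x a) x (F x)) =
      fill A a F (x + 1) := by
  simp only [fill, Function.update_idem, Function.update_self]
  congr 1
  funext i
  rcases lt_trichotomy i x with h | h | h
  · rw [Function.update_of_ne h.ne, if_pos h, if_pos (by omega)]
  · subst h; simp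
  · rw [Function.update_of_ne h.ne', if_neg (by omega), if_neg (by omega)]

theorem size_fill_le {A : ℕ → ℕ → ℕ} {a : ℕ} {F : ℕ → ℕ} {n L : ℕ}
    (hA : ∀ a i, Nat.size (A a i) ≤ L) (hF : ∀ x < n, Nat.size (F x) ≤ L) {x : ℕ} (hx : x ≤ n)
    (a' i : ℕ) : Nat.size (fill A a F x a' i) ≤ L := by
  unfold fill
  by_cases h : a' = a
  · subst h
    rw [Function.update_self]
    split_ifs with hi
    · exact hF i (by omega)
    · exact hA _ _
  · rw [Function.update_of_ne h]
    exact hA _ _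

/-- The body of `forStore`. -/
def storeStep (a : ℕ) (e : Expr) : Prog :=
  .seq (e.compile 3) (.seq (.store a 0 3) (.seq (.const 2 1)
    (.seq (.arith .add 0 0 2) (.arith .sub 1 1 2))))

/-- `for x < bound do a[x] := e`. -/
def forStore (a : ℕ) (bound e : Expr) : Prog :=
  .seq (.const 0 0) (.seq (bound.compile 1) (.loop 1 (storeStep a e)))

/-- Register `0` counts up while register `1` counts down, with constant sum `n`. In `he` the
expression is evaluated on the partly filled array, so that it may refer to entries written earlier.
-/
theorem exists_run_storeLoop {A : ℕ → ℕ → ℕ} {a : ℕ} {F : ℕ → ℕ} {n L : ℕ} {e : Expr}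
    (hA : ∀ a i, Nat.size (A a i) ≤ L) (hF : ∀ x < n, Nat.size (F x) ≤ L) (hn : Nat.size n ≤ L)
    (he : ∀ x < n, e.eval (fill A a F x) x = F x) (r : ℕ) :
    ∀ (x : ℕ) (s : State), x + r = n → s.reg 0 = x → s.reg 1 = r → s.arr = fill A a F x →
    ∃ s' t, Run (.loop 1 (storeStep a e)) s s' t ∧ s'.arr = fill A a F n ∧
      (∀ y, 3 + e.width ≤ y → s'.reg y = s.reg y) ∧ t ≤ r * ((e.cost + 12) * (L + 1)) + 1 := by
  induction r with
  | zero =>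
    intro x s hx h0 h1 hs
    refine ⟨s, _, .loop_done h1, ?_, fun _ _ => rfl, ?_⟩
    · rw [hs, ← hx, Nat.add_zero]
    · rw [h1]; simp
  | succ r ih =>
    intro x s hx h0 h1 hs
    have hA' : ∀ a i, Nat.size (s.arr a i) ≤ L := by
      rw [hs]; exact size_fill_le hA hF (by omega)
    have hxs : Nat.size (s.reg 0) ≤ L := by
      rw [h0]; exact (Nat.size_le_size (by omega)).trans hn
    obtain ⟨s₁, t₁, r₁, a₁, v₁, u₁, b₁⟩ := e.exists_run_compile 3 s (by norm_num) hA' hxs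
    rw [h0, hs, he x (by omega)] at v₁
    have h10 : s₁.reg 0 = x := by rw [u₁ 0 (by omega), h0]
    have h11 : s₁.reg 1 = r + 1 := by rw [u₁ 1 (by omega), h1]
    have e1 : Nat.size (r + 1) ≤ L := (Nat.size_le_size (by omega)).trans hn
    have e2 : Nat.size x ≤ L := h0 ▸ hxs
    have e3 : Nat.size (F x) ≤ L := hF x (by omega)
    obtain ⟨s₂, t₂, r₂, c0, c1, ca, cu, ct⟩ : ∃ s₂ t₂, Run (storeStep a e) s s₂ t₂ ∧
        s₂.reg 0 = x + 1 ∧ s₂.reg 1 = r ∧ s₂.arr = fill A a F (x + 1) ∧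
        (∀ y, 3 + e.width ≤ y → s₂.reg y = s.reg y) ∧ t₂ ≤ (e.cost + 10) * (L + 1) := by
      refine ⟨_, _, .seq r₁ (.seq (.store s₁ a 0 3) (.seq (.const _ 2 1)
        (.seq (.arith _ .add 0 0 2) (.arith _ .sub 1 1 2)))), ?_, ?_, ?_, ?_, ?_⟩
      · simp [State.setReg, State.setArr, Function.update, ArithOp.eval, h10]
      · simp [State.setReg, State.setArr, Function.update, ArithOp.eval, h11]
      · simp only [State.setReg, State.setArr, h10, v₁, a₁, hs]
        exact fill_succ A a F x
      · intro y hy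
        have h1 : y ≠ 1 := by omega
        have h2 : y ≠ 2 := by omega
        have h3 : y ≠ 0 := by omega
        simp only [State.setReg, State.setArr, Function.update, h1, h2, h3, dite_false]
        exact u₁ y (Or.inr hy)
      · simp [State.setReg, State.setArr, Function.update, ArithOp.eval, h10, h11, v₁]
        nlinarith
    obtain ⟨s', t', r', a', u', b'⟩ := ih (x + 1) s₂ (by omega) c0 c1 ca
    refine ⟨s', _, .loop_step (by rw [h1]; omega) r₂ r', a', ?_, ?_⟩
    · intro y hy
      rw [u' y hy, cu y hy]
    · rw [h1]
      nlinarith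

theorem exists_run_forStore {a : ℕ} {F : ℕ → ℕ} {n L : ℕ} {bound e : Expr} (s : State)
    (hA : ∀ a i, Nat.size (s.arr a i) ≤ L) (hF : ∀ x < n, Nat.size (F x) ≤ L)
    (hn : Nat.size n ≤ L) (hb : bound.eval s.arr 0 = n)
    (he : ∀ x < n, e.eval (fill s.arr a F x) x = F x) :
    ∃ s' t, Run (forStore a bound e) s s' t ∧ s'.arr = fill s.arr a F n ∧
      (∀ y, 3 + e.width + bound.width ≤ y → s'.reg y = s.reg y) ∧
      t ≤ (n + 1) * ((e.cost + bound.cost + 14) * (L + 1)) := by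
  obtain ⟨s₁, t₁, r₁, a₁, v₁, u₁, b₁⟩ := bound.exists_run_compile (L := L) 1 (s.setReg 0 0)
    (by norm_num) hA (by simp [State.setReg])
  have h0 : s₁.reg 0 = 0 := by rw [u₁ 0 (by omega)]; simp [State.setReg]
  have h1 : s₁.reg 1 = n := by rw [v₁, ← hb]; simp [State.setReg]
  obtain ⟨s', t', r', a', u', b'⟩ := exists_run_storeLoop hA hF hn he n 0 s₁ (by omega) h0 h1
    (by rw [fill_zero, a₁]; rfl)
  refine ⟨s', _, .seq (.const s 0 0) (.seq r₁ r'), a', ?_, ?_⟩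
  · intro y hy
    rw [u' y (by omega), u₁ y (by omega)]
    have : y ≠ 0 := by omega
    simp [State.setReg, Function.update, this]
  · simp only [Nat.size_zero]
    nlinarith [Nat.zero_le (n * (bound.cost * (L + 1))), Nat.zero_le (n * L),
      Nat.zero_le (e.cost * (L + 1))]

/-! ### Renaming registers and arrays -/

/-- The program with its registers and arrays renamed. -/
def Prog.rename (f g : ℕ → ℕ) : Prog → Prog
  | .const x c => .const (f x) c
  | .arith o x y z => .arith o (f x) (f y) (f z)
  | .load x a y => .load (f x) (g a) (f y)
  | .store a y z => .store (g a) (f y) (f z)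
  | .seq p q => .seq (p.rename f g) (q.rename f g)
  | .cond x p q => .cond (f x) (p.rename f g) (q.rename f g)
  | .loop x p => .loop (f x) (p.rename f g)

/-- The state seen by a renamed program. -/
def State.pull (f g : ℕ → ℕ) (s : State) : State where
  reg := s.reg ∘ f
  arr := s.arr ∘ g

theorem State.pull_setReg {f g : ℕ → ℕ} (hf : Function.Injective f) (s : State) (x v : ℕ) :
    (s.setReg (f x) v).pull f g = (s.pull f g).setReg x v := by
  simp [State.pull, State.setReg, Function.update_comp_eq_of_injective _ hf]

theorem State.pull_setArr {f g : ℕ → ℕ} (hg : Function.Injective g) (s : State) (a i v : ℕ) :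
    (s.setArr (g a) i v).pull f g = (s.pull f g).setArr a i v := by
  simp [State.pull, State.setArr, Function.update_comp_eq_of_injective _ hg]

/-- Injectivity makes every write commute with `State.pull`, so the run is copied step by step
inside a larger state. The time is unchanged because names of registers and arrays are not charged.
-/
theorem Run.rename {f g : ℕ → ℕ} (hf : Function.Injective f) (hg : Function.Injective g)
    {p : Prog} {s s' : State} {t : ℕ} (h : Run p s s' t) :
    ∀ S : State, S.pull f g = s → ∃ S', S'.pull f g = s' ∧ Run (p.rename f g) S S' t := by
  induction h with
  | const s x c =>
    rintro S rfl
    exact ⟨_, State.pull_setReg hf _ _ _, .const _ _ _⟩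
  | arith s op x y z =>
    rintro S rfl
    exact ⟨_, State.pull_setReg hf _ _ _, .arith _ _ _ _ _⟩
  | load s x a y =>
    rintro S rfl
    exact ⟨_, State.pull_setReg hf _ _ _, .load _ _ _ _⟩
  | store s a y z =>
    rintro S rfl
    exact ⟨_, State.pull_setArr hg _ _ _ _, .store _ _ _ _⟩
  | seq _ _ h₁ h₂ =>
    intro S hS
    obtain ⟨S₁, e₁, r₁⟩ := h₁ S hS
    obtain ⟨S₂, e₂, r₂⟩ := h₂ S₁ e₁
    exact ⟨S₂, e₂, .seq r₁ r₂⟩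
  | cond_true hx _ h =>
    rintro S rfl
    obtain ⟨S₁, e₁, r₁⟩ := h S rfl
    exact ⟨S₁, e₁, .cond_true hx r₁⟩
  | cond_false hx _ h =>
    rintro S rfl
    obtain ⟨S₁, e₁, r₁⟩ := h S rfl
    exact ⟨S₁, e₁, .cond_false hx r₁⟩
  | loop_done hx =>
    rintro S rfl
    exact ⟨S, rfl, .loop_done hx⟩
  | loop_step hx _ _ h₁ h₂ =>
    rintro S rfl
    obtain ⟨S₁, e₁, r₁⟩ := h₁ S rfl
    obtain ⟨S₂, e₂, r₂⟩ := h₂ S₁ e₁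
    exact ⟨S₂, e₂, .loop_step hx r₁ r₂⟩

theorem Run.time_pos {p : Prog} {s s' : State} {t : ℕ} (h : Run p s s' t) : 0 < t := by
  induction h <;> omega

/-- If a program solves `Q` on the word that is left in array `K` by a program for the reduction,
then the two together solve `P`. -/
theorem exists_run_of_reduction {P Q : DecisionProblem} {red : P.Instance → Q.Instance}
    (hred : ∀ x, Q.Yes (red x) ↔ P.Yes x) {T : P.Instance → ℕ} {prog : Prog} {R K : ℕ}
    (hprog : ∀ x, ∃ s t, Run prog (initState (P.encode x)) s t ∧ (∀ y, R ≤ y → s.reg y = 0) ∧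
      s.arr K = (fun i => (Q.encode (red x)).getD i 0) ∧ (∀ a, K < a → s.arr a = fun _ => 0) ∧
      t ≤ T x) (p : Prog) :
    ∃ p' : Prog, ∀ x s t, Run p (initState (Q.encode (red x))) s t →
      (s.reg 0 ≠ 0 ↔ Q.Yes (red x)) → ∃ s' t', Run p' (initState (P.encode x)) s' t' ∧
        (s'.reg 0 ≠ 0 ↔ P.Yes x) ∧ t' ≤ T x + 1 + t := by
  -- Register `0` stays in place because it holds the answer; the others move past the registers
  -- touched by `prog`, where everything is still zero.
  let f : ℕ → ℕ := fun x => if x = 0 then 0 else x + R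
  let g : ℕ → ℕ := fun a => a + K
  have hf : Function.Injective f := by
    intro x y h
    simp only [f] at h
    split_ifs at h <;> omega
  have hg : Function.Injective g := fun x y h => by simpa [g] using h
  -- Register `0` is the only register of the renamed program that `prog` may leave nonzero, so it
  -- is cleared.
  refine ⟨.seq prog (.seq (.const 0 0) (p.rename f g)), fun x s t hr hs => ?_⟩
  obtain ⟨s₁, t₁, r₁, h₁, h₂, h₃, h₄⟩ := hprog x
  obtain ⟨S, e, r₂⟩ := hr.rename hf hg (s₁.setReg 0 0) (by
    simp only [State.pull, State.setReg, initState]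
    congr 1
    · funext y
      by_cases hy : y = 0
      · simp [f, hy]
      · simp only [Function.comp, f, hy, if_false]
        rw [Function.update_of_ne (by omega)]
        exact h₁ _ (by omega)
    · funext a i
      by_cases ha : a = 0
      · simp [g, ha, h₂]
      · simp only [Function.comp, g, ha, if_false]
        rw [h₃ (a + K) (by omega)])
  refine ⟨S, _, .seq r₁ (.seq (.const _ 0 0) r₂), ?_, ?_⟩
  · rw [← hred, ← hs, ← e]
    simp [State.pull, f]
  · simp; omega

/-! ### The gadget graph -/

/-- The vertices of a cell. -/
inductive Loc (t₀ t : ℕ)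
  | r
  | p
  | c
  | z (α : Fin t₀ → Bool)
  | q (i : Fin t)
  | q' (i : Fin t)
  | s (i : Fin t)
  | b (i : Fin t)
  | s' (i : Fin t)
  | a (i : Fin t)
  deriving DecidableEq, Fintype

/-- The data of the construction: a word over three letters for each assignment of a group of
`t₀` variables, the number of groups, the number of clauses, and the predicate telling whether an
assignment of a group satisfies a clause. -/
structure Layout (t₀ t : ℕ) where
  W : (Fin t₀ → Bool) → Fin t → Fin 3
  G : ℕ
  m : ℕ
  hit : ℕ → ℕ → (Fin t₀ → Bool) → Prop

variable {t₀ t d : ℕ}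

/-- The edges inside of a cell that do not depend on its position. -/
inductive Static (W : (Fin t₀ → Bool) → Fin t → Fin 3) : Loc t₀ t → Loc t₀ t → Prop
  | pz (α) : Static W .p (.z α)
  | zr (α) : Static W (.z α) .r
  | zs (α) (i) (h : W α i ≠ 0) : Static W (.z α) (.s i)
  | zb (α) (i) (h : W α i = 2) : Static W (.z α) (.b i)
  | zs' (α) (i) (h : W α i ≠ 2) : Static W (.z α) (.s' i)
  | za (α) (i) (h : W α i = 0) : Static W (.z α) (.a i)
  | qs (i) : Static W (.q i) (.s i)
  | qb (i) : Static W (.q i) (.b i)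
  | qs' (i) : Static W (.q' i) (.s' i)
  | qa (i) : Static W (.q' i) (.a i)

/-- The edges of the gadget graph, each in one direction. Cell `k` belongs to the group `k % G`
and to the column `k / G`. -/
inductive Layout.Link (Λ : Layout t₀ t) : ℕ → Loc t₀ t → ℕ → Loc t₀ t → Prop
  | static (k) {l l'} (h : Static Λ.W l l') : Link Λ k l k l'
  | root (k) : Link Λ k .r (k + 1) .r
  | track (k) (i) : Link Λ k (.b i) (k + Λ.G) (.a i)
  | first (k) (i) (h : k < Λ.G) : Link Λ k (.a i) k .r
  | last (k) (i) (h : Λ.m * Λ.G ≤ k) : Link Λ k (.b i) k .r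
  | free (k) (h : ¬(k % Λ.G = 0 ∧ k / Λ.G < Λ.m)) : Link Λ k .c k .r
  | clause (k k') (α) (h₀ : k % Λ.G = 0) (hm : k / Λ.G < Λ.m) (hk : k' / Λ.G = k / Λ.G)
      (h : Λ.hit (k / Λ.G) (k' % Λ.G) α) : Link Λ k .c k' (.z α)

/-- The gadget graph, with infinitely many cells. -/
def Layout.graph (Λ : Layout t₀ t) : SimpleGraph (ℕ × Loc t₀ t) :=
  SimpleGraph.fromRel fun u v => Λ.Link u.1 u.2 v.1 v.2

/-- The number of cells. -/
def Layout.numCells (Λ : Layout t₀ t) : ℕ := (Λ.m + 1) * Λ.G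

/-- The local vertices that are terminals. -/
def Loc.IsTerminal : Loc t₀ t → Prop
  | .r | .p | .c | .q _ | .q' _ => True
  | _ => False

/-- A representative of the class of a local vertex: a solution of minimum size contains exactly
one vertex of each class. -/
def Loc.cls : Loc t₀ t → Loc t₀ t
  | .z _ => .z fun _ => false
  | .b i => .s i
  | .a i => .s' i
  | l => l

/-- The number of classes. -/
def numClasses (t₀ t : ℕ) : ℕ := (Finset.univ.image (Loc.cls (t₀ := t₀) (t := t))).card

/-! ### Neighbourhoods in the gadget graph. -/

namespace Layout

variable {Λ : Layout t₀ t} {k : ℕ} {v : ℕ × Loc t₀ t}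

theorem adj_iff {u v : ℕ × Loc t₀ t} : Λ.graph.Adj u v ↔
    u ≠ v ∧ (Λ.Link u.1 u.2 v.1 v.2 ∨ Λ.Link v.1 v.2 u.1 u.2) := SimpleGraph.fromRel_adj _ _ _

theorem link_or_link {l l' : Loc t₀ t} {k' : ℕ} (h : Λ.graph.Adj (k, l) (k', l')) :
    Λ.Link k l k' l' ∨ Λ.Link k' l' k l := (adj_iff.1 h).2

theorem adj_p (h : Λ.graph.Adj (k, .p) v) : ∃ α, v = (k, .z α) := by
  obtain ⟨k', l⟩ := v
  rcases link_or_link h with h | h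
  · cases h with
    | static h => cases h with
      | pz α => exact ⟨α, rfl⟩
  · cases h with
    | static h => cases h

theorem adj_q {i : Fin t} (h : Λ.graph.Adj (k, .q i) v) : v = (k, .s i) ∨ v = (k, .b i) := by
  obtain ⟨k', l⟩ := v
  rcases link_or_link h with h | h
  · cases h with
    | static h => cases h <;> simp
  · cases h with
    | static h => cases h

theorem adj_q' {i : Fin t} (h : Λ.graph.Adj (k, .q' i) v) : v = (k, .s' i) ∨ v = (k, .a i) := by
  obtain ⟨k', l⟩ := v
  rcases link_or_link h with h | h
  · cases h with
    | static h => cases h <;> simp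
  · cases h with
    | static h => cases h

theorem adj_s {i : Fin t} (h : Λ.graph.Adj (k, .s i) v) :
    v = (k, .q i) ∨ ∃ α, Λ.W α i ≠ 0 ∧ v = (k, .z α) := by
  obtain ⟨k', l⟩ := v
  rcases link_or_link h with h | h
  · cases h with
    | static h => cases h
  · cases h with
    | static h => cases h with
      | zs α _ h => exact Or.inr ⟨α, h, rfl⟩
      | qs => exact Or.inl rfl

theorem adj_s' {i : Fin t} (h : Λ.graph.Adj (k, .s' i) v) :
    v = (k, .q' i) ∨ ∃ α, Λ.W α i ≠ 2 ∧ v = (k, .z α) := by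
  obtain ⟨k', l⟩ := v
  rcases link_or_link h with h | h
  · cases h with
    | static h => cases h
  · cases h with
    | static h => cases h with
      | zs' α _ h => exact Or.inr ⟨α, h, rfl⟩
      | qs' => exact Or.inl rfl

/-- The root neighbour in the last column is not identified: the lemma is applied only to cells with
a successor in their row, where the last alternative is void. In `adj_a` the first column is treated
likewise. -/
theorem adj_b {i : Fin t} (h : Λ.graph.Adj (k, .b i) v) :
    v = (k, .q i) ∨ (∃ α, Λ.W α i = 2 ∧ v = (k, .z α)) ∨ v = (k + Λ.G, .a i) ∨
      Λ.m * Λ.G ≤ k := by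
  obtain ⟨k', l⟩ := v
  rcases link_or_link h with h | h
  · cases h with
    | static h => cases h
    | track => simp
    | last => simp [*]
  · cases h with
    | static h => cases h with
      | zb α _ h => exact Or.inr (Or.inl ⟨α, h, rfl⟩)
      | qb => exact Or.inl rfl

theorem adj_a {i : Fin t} (h : Λ.graph.Adj (k, .a i) v) :
    v = (k, .q' i) ∨ (∃ α, Λ.W α i = 0 ∧ v = (k, .z α)) ∨ (v.2 = .b i ∧ v.1 + Λ.G = k) ∨
      k < Λ.G := by
  obtain ⟨k', l⟩ := v
  rcases link_or_link h with h | h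
  · cases h with
    | static h => cases h
    | first => simp [*]
  · cases h with
    | static h => cases h with
      | za α _ h => exact Or.inr (Or.inl ⟨α, h, rfl⟩)
      | qa => exact Or.inl rfl
    | track => simp

theorem adj_c (h : Λ.graph.Adj (k, .c) v) (h₀ : k % Λ.G = 0) (hm : k / Λ.G < Λ.m) :
    ∃ k' α, v = (k', .z α) ∧ k' / Λ.G = k / Λ.G ∧ Λ.hit (k / Λ.G) (k' % Λ.G) α := by
  obtain ⟨k', l⟩ := v
  rcases link_or_link h with h | h
  · cases h with
    | static h => cases h
    | free => exact absurd (And.intro h₀ hm) ‹_›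
    | clause _ α _ _ h₁ h₂ => exact ⟨_, _, rfl, h₁, h₂⟩
  · cases h with
    | static h => cases h

end Layout

/-! ### Connected sets -/

/-- A walk inside `S` from `x` to `y` has to leave `X` along some edge. Every impossibility proof
below exhibits a set `X` without such an edge. -/
theorem exists_adj_of_connected {V : Type*} {H : SimpleGraph V} {S : Set V}
    (hS : (H.induce S).Connected) (X : Set V) {x y : V} (hx : x ∈ S) (hxX : x ∈ X) (hy : y ∈ S)
    (hyX : y ∉ X) : ∃ u v, u ∈ S ∧ u ∈ X ∧ v ∈ S ∧ v ∉ X ∧ H.Adj u v := by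
  obtain ⟨w⟩ := hS.preconnected ⟨x, hx⟩ ⟨y, hy⟩
  obtain ⟨d, -, h1, h2⟩ := w.exists_boundary_dart {u | (u : V) ∈ X} hxX hyX
  exact ⟨d.fst, d.snd, d.fst.2, h1, d.snd.2, h2, d.adj⟩

/-- `v` can be joined to `x` within `S`. -/
def Joined {V : Type*} (H : SimpleGraph V) (S : Set V) (x : S) (v : V) : Prop :=
  ∃ h : v ∈ S, (H.induce S).Reachable ⟨v, h⟩ x

theorem Joined.step {V : Type*} {H : SimpleGraph V} {S : Set V} {x : S} {u v : V}
    (hv : Joined H S x v) (hu : u ∈ S) (h : H.Adj u v) : Joined H S x u := by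
  obtain ⟨hv, hr⟩ := hv
  have : (H.induce S).Adj ⟨u, hu⟩ ⟨v, hv⟩ := h
  exact ⟨hu, this.reachable.trans hr⟩

theorem connected_of_joined {V : Type*} {H : SimpleGraph V} {S : Set V} (x : S)
    (h : ∀ v ∈ S, Joined H S x v) : (H.induce S).Connected := by
  have : Nonempty S := ⟨x⟩
  refine ⟨fun u v => ?_⟩
  obtain ⟨_, hu⟩ := h u u.2
  obtain ⟨_, hv⟩ := h v v.2
  exact hu.trans hv.symm

/-! ### From a Steiner tree to an assignment. -/

namespace Layout

variable (Λ : Layout t₀ t)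

/-- The vertex set of the gadget graph. -/
def verts : Finset (ℕ × Loc t₀ t) := Finset.range Λ.numCells ×ˢ Finset.univ

/-- `S` is a Steiner tree of the gadget graph with at most one vertex per class on average. -/
structure IsSolution (S : Finset (ℕ × Loc t₀ t)) : Prop where
  subset : S ⊆ Λ.verts
  card_le : S.card ≤ Λ.numCells * numClasses t₀ t
  terminal : ∀ k < Λ.numCells, ∀ l : Loc t₀ t, l.IsTerminal → (k, l) ∈ S
  connected : (Λ.graph.induce (S : Set (ℕ × Loc t₀ t))).Connected

/-- The words can only be the same if they are of the same type. -/
def Separated (W : (Fin t₀ → Bool) → Fin t → Fin 3) : Prop :=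
  ∀ α β, (∀ i, W α i = 0 → W β i = 0) → (∀ i, W β i = 2 → W α i = 2) → α = β

variable {Λ} {S : Finset (ℕ × Loc t₀ t)}

namespace IsSolution

theorem exists_adj (hS : Λ.IsSolution S) (X : Set (ℕ × Loc t₀ t)) {k : ℕ} {x : ℕ × Loc t₀ t}
    (hk : k < Λ.numCells) (hx : x ∈ S) (hxX : x ∈ X) (hr : (k, Loc.r) ∉ X) :
    ∃ u v, u ∈ S ∧ u ∈ X ∧ v ∈ S ∧ v ∉ X ∧ Λ.graph.Adj u v := by
  simpa using exists_adj_of_connected hS.connected X (x := x) (y := (k, .r)) (by simpa using hx)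
    hxX (by simpa using hS.terminal k hk .r trivial) hr

theorem exists_neighbor (hS : Λ.IsSolution S) {k : ℕ} {l : Loc t₀ t} (hk : k < Λ.numCells)
    (hl : l.IsTerminal) (hr : l ≠ .r) : ∃ v ∈ S, Λ.graph.Adj (k, l) v := by
  obtain ⟨u, v, -, rfl, hv, -, h⟩ := hS.exists_adj {(k, l)} (k := k) (x := (k, l)) hk
    (hS.terminal k hk l hl) rfl (by simpa using hr.symm)
  exact ⟨v, hv, h⟩

theorem exists_z (hS : Λ.IsSolution S) {k : ℕ} (hk : k < Λ.numCells) : ∃ α, (k, Loc.z α) ∈ S := by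
  obtain ⟨v, hv, h⟩ := hS.exists_neighbor (l := .p) hk trivial (by simp)
  obtain ⟨α, rfl⟩ := adj_p h
  exact ⟨α, hv⟩

theorem s_or_b (hS : Λ.IsSolution S) {k : ℕ} (hk : k < Λ.numCells) (i : Fin t) :
    (k, Loc.s i) ∈ S ∨ (k, Loc.b i) ∈ S := by
  obtain ⟨v, hv, h⟩ := hS.exists_neighbor (l := .q i) hk trivial (by simp)
  rcases adj_q h with rfl | rfl
  · exact Or.inl hv
  · exact Or.inr hv

theorem s'_or_a (hS : Λ.IsSolution S) {k : ℕ} (hk : k < Λ.numCells) (i : Fin t) :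
    (k, Loc.s' i) ∈ S ∨ (k, Loc.a i) ∈ S := by
  obtain ⟨v, hv, h⟩ := hS.exists_neighbor (l := .q' i) hk trivial (by simp)
  rcases adj_q' h with rfl | rfl
  · exact Or.inl hv
  · exact Or.inr hv

theorem lt_numCells (hS : Λ.IsSolution S) {k : ℕ} {l : Loc t₀ t} (h : (k, l) ∈ S) :
    k < Λ.numCells := by
  have := hS.subset h
  simp only [verts, Finset.mem_product, Finset.mem_range] at this
  exact this.1

/-- The terminals, and the neighbours they need, force `S` to meet every class of every cell. The
budget equals the number of these classes, so no class is met twice. -/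
theorem injOn_cls (hS : Λ.IsSolution S) :
    Set.InjOn (fun v : ℕ × Loc t₀ t => (v.1, v.2.cls)) (S : Set (ℕ × Loc t₀ t)) := by
  rw [← Finset.card_image_iff]
  refine le_antisymm Finset.card_image_le (hS.card_le.trans ?_)
  rw [numClasses, ← Finset.card_range Λ.numCells, ← Finset.card_product]
  refine Finset.card_le_card ?_
  rintro ⟨k, l⟩ h
  simp only [Finset.mem_product, Finset.mem_range, Finset.mem_image, Finset.mem_univ,
    true_and] at h
  obtain ⟨hk, l, rfl⟩ := h
  simp only [Finset.mem_image, Prod.mk.injEq]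
  have key : ∀ l' : Loc t₀ t, (k, l') ∈ S → l'.cls = l.cls →
      ∃ a ∈ S, a.1 = k ∧ a.2.cls = l.cls := fun l' h e => ⟨(k, l'), h, rfl, e⟩
  cases l with
  | z α => obtain ⟨β, h⟩ := hS.exists_z hk; exact key _ h rfl
  | s i | b i => rcases hS.s_or_b hk i with h | h <;> exact key _ h rfl
  | s' i | a i => rcases hS.s'_or_a hk i with h | h <;> exact key _ h rfl
  | r => exact key .r (hS.terminal k hk _ trivial) rfl
  | p => exact key .p (hS.terminal k hk _ trivial) rfl
  | c => exact key .c (hS.terminal k hk _ trivial) rfl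
  | q i => exact key (.q i) (hS.terminal k hk _ trivial) rfl
  | q' i => exact key (.q' i) (hS.terminal k hk _ trivial) rfl

theorem eq_of_cls_eq (hS : Λ.IsSolution S) {k : ℕ} {l l' : Loc t₀ t} (h : (k, l) ∈ S)
    (h' : (k, l') ∈ S) (e : l.cls = l'.cls) : l = l' := by
  have := hS.injOn_cls (by simpa using h) (by simpa using h') (by simp [e])
  simpa using this

theorem z_unique (hS : Λ.IsSolution S) {k : ℕ} {α β : Fin t₀ → Bool} (h : (k, Loc.z α) ∈ S)
    (h' : (k, Loc.z β) ∈ S) : α = β := by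
  simpa using hS.eq_of_cls_eq h h' rfl

/-- With letter 0 the selected `z α` is not adjacent to `s i`, and `b i` is excluded as a second
vertex of the same class. The pair `s i`, `q i` would therefore be cut off from the root. -/
theorem not_s_mem (hS : Λ.IsSolution S) {k : ℕ} {α : Fin t₀ → Bool} (hα : (k, Loc.z α) ∈ S)
    {i : Fin t} (h : Λ.W α i = 0) : (k, Loc.s i) ∉ S := by
  intro hs
  obtain ⟨u, v, hu, rfl | rfl, hv, hv', hadj⟩ := hS.exists_adj {(k, .s i), (k, .q i)} (k := k)
    (hS.lt_numCells hα) hs (by simp) (by simp)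
  · rcases adj_s hadj with rfl | ⟨β, hβ, rfl⟩
    · simp at hv'
    · exact hβ (hS.z_unique hα hv ▸ h)
  · rcases adj_q hadj with rfl | rfl
    · simp at hv'
    · simpa using hS.eq_of_cls_eq hs hv rfl

theorem not_s'_mem (hS : Λ.IsSolution S) {k : ℕ} {α : Fin t₀ → Bool} (hα : (k, Loc.z α) ∈ S)
    {i : Fin t} (h : Λ.W α i = 2) : (k, Loc.s' i) ∉ S := by
  intro hs
  obtain ⟨u, v, hu, rfl | rfl, hv, hv', hadj⟩ := hS.exists_adj {(k, .s' i), (k, .q' i)} (k := k)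
    (hS.lt_numCells hα) hs (by simp) (by simp)
  · rcases adj_s' hadj with rfl | ⟨β, hβ, rfl⟩
    · simp at hv'
    · exact hβ (hS.z_unique hα hv ▸ h)
  · rcases adj_q' hadj with rfl | rfl
    · simp at hv'
    · simpa using hS.eq_of_cls_eq hs hv rfl

theorem lt_of_add_lt {k : ℕ} (h : k + Λ.G < Λ.numCells) : ¬ Λ.m * Λ.G ≤ k := by
  unfold numCells at h
  rw [Nat.add_mul] at h
  omega

/-- The component of the pair `b i`, `a i` between the cells `k` and `k + G` contains one of the
two selection vertices. -/
theorem track_aux (hS : Λ.IsSolution S) {k : ℕ} {α β : Fin t₀ → Bool} (hα : (k, Loc.z α) ∈ S)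
    (hβ : (k + Λ.G, Loc.z β) ∈ S) {i : Fin t}
    (hb : (k, Loc.b i) ∈ S ∨ (k + Λ.G, Loc.a i) ∈ S)
    (hα₂ : (k, Loc.b i) ∈ S → Λ.W α i ≠ 2) (hβ₀ : (k + Λ.G, Loc.a i) ∈ S → Λ.W β i ≠ 0) :
    False := by
  have hk := hS.lt_numCells hβ
  -- Each half of `X` is present only if its track vertex is selected. Its terminal then has no exit
  -- through `s i` or `s' i`, which would be a second vertex of the class.
  let X : Set (ℕ × Loc t₀ t) := {v | ((k, Loc.b i) ∈ S ∧ (v = (k, .b i) ∨ v = (k, .q i))) ∨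
    ((k + Λ.G, Loc.a i) ∈ S ∧ (v = (k + Λ.G, .a i) ∨ v = (k + Λ.G, .q' i)))}
  obtain ⟨u, v, hu, hX, hv, hv', hadj⟩ : ∃ u v, u ∈ S ∧ u ∈ X ∧ v ∈ S ∧ v ∉ X ∧
      Λ.graph.Adj u v := by
    rcases hb with hb | hb
    · exact hS.exists_adj X hk hb (Or.inl ⟨hb, Or.inl rfl⟩) (by simp [X])
    · exact hS.exists_adj X hk hb (Or.inr ⟨hb, Or.inl rfl⟩) (by simp [X])
  rcases hX with ⟨hb, rfl | rfl⟩ | ⟨ha, rfl | rfl⟩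
  · rcases adj_b hadj with rfl | ⟨γ, hγ, rfl⟩ | rfl | h
    · exact hv' (Or.inl ⟨hb, Or.inr rfl⟩)
    · exact hα₂ hb (hS.z_unique hα hv ▸ hγ)
    · exact hv' (Or.inr ⟨hv, Or.inl rfl⟩)
    · exact lt_of_add_lt hk h
  · rcases adj_q hadj with rfl | rfl
    · simpa using hS.eq_of_cls_eq hb hv rfl
    · exact hv' (Or.inl ⟨hb, Or.inl rfl⟩)
  · rcases adj_a hadj with rfl | ⟨γ, hγ, rfl⟩ | ⟨h₂, h₁⟩ | h
    · exact hv' (Or.inr ⟨ha, Or.inr rfl⟩)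
    · exact hβ₀ ha (hS.z_unique hβ hv ▸ hγ)
    · obtain ⟨k', l⟩ := v
      obtain rfl : l = .b i := h₂
      obtain rfl : k' = k := by simpa using h₁
      exact hv' (Or.inl ⟨hv, Or.inl rfl⟩)
    · omega
  · rcases adj_q' hadj with rfl | rfl
    · simpa using hS.eq_of_cls_eq ha hv rfl
    · exact hv' (Or.inr ⟨ha, Or.inl rfl⟩)

/-- A letter 0 in the left cell forces `b i` into `S` without a link to its own `z α`, so `a i` in
the next cell must supply one, which needs letter 0 there. A letter 2 in the right cell acts
symmetrically to the left. `Separated` turns the two inclusions into equality. -/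
theorem z_next (hS : Λ.IsSolution S) (hW : Separated Λ.W) {k : ℕ} {α β : Fin t₀ → Bool}
    (hα : (k, Loc.z α) ∈ S) (hβ : (k + Λ.G, Loc.z β) ∈ S) : α = β := by
  refine hW α β (fun i h => ?_) (fun i h => ?_) <;> by_contra hne
  · have hb := (hS.s_or_b (hS.lt_numCells hα) i).resolve_left (hS.not_s_mem hα h)
    exact hS.track_aux hα hβ (Or.inl hb) (fun _ => by simp [h]) fun _ => hne
  · have ha := (hS.s'_or_a (hS.lt_numCells hβ) i).resolve_left (hS.not_s'_mem hβ h)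
    exact hS.track_aux hα hβ (Or.inr ha) (fun _ => hne) fun _ => by simp [h]

theorem z_column (hS : Λ.IsSolution S) (hW : Separated Λ.W) {g : ℕ} {α : Fin t₀ → Bool}
    (hα : (g, Loc.z α) ∈ S) (j : ℕ) {β : Fin t₀ → Bool} (hβ : (g + j * Λ.G, Loc.z β) ∈ S) :
    β = α := by
  induction j generalizing β with
  | zero => exact hS.z_unique (by simpa using hβ) hα
  | succ j ih =>
    have hk := hS.lt_numCells hβ
    obtain ⟨γ, hγ⟩ := hS.exists_z (k := g + j * Λ.G) (by rw [Nat.add_mul] at hk; omega)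
    rw [← ih hγ]
    refine (hS.z_next hW hγ ?_).symm
    rwa [show g + j * Λ.G + Λ.G = g + (j + 1) * Λ.G by ring]

/-- The assignment is read off in column `0`. The clause vertex of column `j` needs a selected
neighbour `z α` in its column, and `z_column` identifies this `α` with the one read off. -/
theorem exists_hit (hS : Λ.IsSolution S) (hW : Separated Λ.W) (hG : 0 < Λ.G) :
    ∃ f : ℕ → Fin t₀ → Bool, ∀ j < Λ.m, ∃ g < Λ.G, Λ.hit j g (f g) := by
  have hlt : ∀ g < Λ.G, g < Λ.numCells := fun g hg => by
    unfold numCells; rw [Nat.add_mul]; omega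
  choose! f hf using fun g (hg : g < Λ.G) => hS.exists_z (hlt g hg)
  refine ⟨f, fun j hj => ?_⟩
  have hk : j * Λ.G < Λ.numCells := by
    unfold numCells
    exact Nat.mul_lt_mul_of_pos_right (by omega) hG
  obtain ⟨v, hv, hadj⟩ := hS.exists_neighbor (l := .c) hk trivial (by simp)
  obtain ⟨k', α, rfl, h₁, h₂⟩ := adj_c hadj (by simp) (by simpa [hG] using hj)
  have hg : k' % Λ.G < Λ.G := Nat.mod_lt _ hG
  refine ⟨k' % Λ.G, hg, ?_⟩
  rw [Nat.mul_div_cancel _ hG] at h₂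
  rwa [← hS.z_column hW (hf _ hg) (k' / Λ.G) (β := α)]
  rwa [mul_comm, Nat.mod_add_div]

end IsSolution

/-! ### From an assignment to a Steiner tree -/

/-- The local vertices selected for the assignment `α`. -/
def Sel (W : (Fin t₀ → Bool) → Fin t → Fin 3) (α : Fin t₀ → Bool) : Loc t₀ t → Prop
  | .z β => β = α
  | .s i => W α i = 1
  | .b i => W α i ≠ 1
  | .s' i => W α i = 1
  | .a i => W α i ≠ 1
  | _ => True

theorem eq_of_sel {W : (Fin t₀ → Bool) → Fin t → Fin 3} {α : Fin t₀ → Bool} {l l' : Loc t₀ t}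
    (h : Sel W α l) (h' : Sel W α l') (e : l.cls = l'.cls) : l = l' := by
  cases l <;> cases l' <;> simp_all [Sel, Loc.cls]

theorem adj_of_link {k k' : ℕ} {l l' : Loc t₀ t} (h : Λ.Link k l k' l') (hl : l ≠ l') :
    Λ.graph.Adj (k, l) (k', l') := adj_iff.2 ⟨by simp [hl], Or.inl h⟩

-- Selected vertices reach the roots as follows: `s i` and `s' i` through `z` for letter 1; for
-- letter 0, `a i` through `z` and `b i` through `a i` of the next cell; for letter 2 the mirror
-- image. At the two ends of a row the missing cell is replaced by an edge to the root.
open Classical in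
theorem exists_isSolution (hG : 0 < Λ.G) {f : ℕ → Fin t₀ → Bool}
    (hf : ∀ j < Λ.m, ∃ g < Λ.G, Λ.hit j g (f g)) : ∃ S, Λ.IsSolution S := by
  let S := Λ.verts.filter fun v => Sel Λ.W (f (v.1 % Λ.G)) v.2
  have mem : ∀ k l, (k, l) ∈ S ↔ k < Λ.numCells ∧ Sel Λ.W (f (k % Λ.G)) l := fun k l => by
    simp [S, verts]
  have h0 : 0 < Λ.numCells := Nat.mul_pos (Nat.succ_pos _) hG
  have hr : ∀ k < Λ.numCells, (k, Loc.r) ∈ S := fun k hk => (mem _ _).2 ⟨hk, trivial⟩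
  refine ⟨S, Finset.filter_subset _ _, ?_, ?_, ?_⟩
  · have : Set.InjOn (fun v : ℕ × Loc t₀ t => (v.1, v.2.cls)) (S : Set (ℕ × Loc t₀ t)) := by
      rintro ⟨k, l⟩ h ⟨k', l'⟩ h' e
      simp only [Prod.mk.injEq] at e
      obtain ⟨rfl, e⟩ := e
      rw [eq_of_sel ((mem _ _).1 h).2 ((mem _ _).1 h').2 e]
    rw [← Finset.card_image_of_injOn this, numClasses, ← Finset.card_range Λ.numCells,
      ← Finset.card_product]
    refine Finset.card_le_card fun v hv => ?_
    obtain ⟨⟨k, l⟩, h, rfl⟩ := Finset.mem_image.1 hv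
    simpa using ((mem _ _).1 h).1
  · intro k hk l hl
    refine (mem _ _).2 ⟨hk, ?_⟩
    cases l <;> simp_all [Sel, Loc.IsTerminal]
  · let x : (S : Set (ℕ × Loc t₀ t)) := ⟨(0, .r), by simpa using hr 0 h0⟩
    refine connected_of_joined x ?_
    have step : ∀ {k l k' l'}, Joined Λ.graph S x (k', l') → (k, l) ∈ S →
        (Λ.Link k l k' l' ∨ Λ.Link k' l' k l) → l ≠ l' → Joined Λ.graph S x (k, l) := by
      intro k l k' l' h hm hl hne
      refine h.step (by simpa using hm) ?_
      rcases hl with hl | hl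
      · exact adj_of_link hl hne
      · exact (adj_of_link hl hne.symm).symm
    have jr : ∀ k < Λ.numCells, Joined Λ.graph S x (k, .r) := by
      intro k
      induction k with
      | zero => exact fun _ => ⟨x.2, SimpleGraph.Reachable.refl _⟩
      | succ k ih =>
        intro hk
        exact (ih (by omega)).step (by simpa using hr _ hk)
          (adj_iff.2 ⟨by simp, Or.inr (.root k)⟩)
    have jz : ∀ k < Λ.numCells, Joined Λ.graph S x (k, .z (f (k % Λ.G))) := fun k hk =>
      step (jr k hk) ((mem _ _).2 ⟨hk, rfl⟩) (Or.inl (.static _ (.zr _))) (by simp)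
    have hG' : ∀ k, (k + Λ.G) % Λ.G = k % Λ.G := fun k => by simp
    have ja₀ : ∀ k < Λ.numCells, ∀ i, Λ.W (f (k % Λ.G)) i = 0 →
        Joined Λ.graph S x (k, .a i) := fun k hk i h =>
      step (jz k hk) ((mem _ _).2 ⟨hk, by simp [Sel, h]⟩)
        (Or.inr (.static _ (.za _ _ h))) (by simp)
    have jb₂ : ∀ k < Λ.numCells, ∀ i, Λ.W (f (k % Λ.G)) i = 2 →
        Joined Λ.graph S x (k, .b i) := fun k hk i h =>
      step (jz k hk) ((mem _ _).2 ⟨hk, by simp [Sel, h]⟩)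
        (Or.inr (.static _ (.zb _ _ h))) (by simp)
    have js : ∀ k < Λ.numCells, ∀ i, Λ.W (f (k % Λ.G)) i = 1 →
        Joined Λ.graph S x (k, .s i) := fun k hk i h =>
      step (jz k hk) ((mem _ _).2 ⟨hk, by simp [Sel, h]⟩)
        (Or.inr (.static _ (.zs _ _ (by simp [h])))) (by simp)
    have js' : ∀ k < Λ.numCells, ∀ i, Λ.W (f (k % Λ.G)) i = 1 →
        Joined Λ.graph S x (k, .s' i) := fun k hk i h =>
      step (jz k hk) ((mem _ _).2 ⟨hk, by simp [Sel, h]⟩)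
        (Or.inr (.static _ (.zs' _ _ (by simp [h])))) (by simp)
    have three : ∀ y : Fin 3, y ≠ 1 → y = 0 ∨ y = 2 := by decide
    have jb : ∀ k < Λ.numCells, ∀ i, Λ.W (f (k % Λ.G)) i ≠ 1 →
        Joined Λ.graph S x (k, .b i) := by
      intro k hk i h
      rcases three _ h with h' | h'
      · by_cases hl : Λ.m * Λ.G ≤ k
        · exact step (jr k hk) ((mem _ _).2 ⟨hk, h⟩) (Or.inl (.last _ _ hl)) (by simp)
        · exact step (ja₀ (k + Λ.G) (by unfold numCells; rw [Nat.add_mul]; omega) i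
            (by rw [hG']; exact h')) ((mem _ _).2 ⟨hk, h⟩) (Or.inl (.track _ _)) (by simp)
      · exact jb₂ k hk i h'
    have ja : ∀ k < Λ.numCells, ∀ i, Λ.W (f (k % Λ.G)) i ≠ 1 →
        Joined Λ.graph S x (k, .a i) := by
      intro k hk i h
      rcases three _ h with h' | h'
      · exact ja₀ k hk i h'
      · by_cases hl : k < Λ.G
        · exact step (jr k hk) ((mem _ _).2 ⟨hk, h⟩) (Or.inl (.first _ _ hl)) (by simp)
        · obtain ⟨k, rfl⟩ : ∃ k', k = k' + Λ.G := ⟨k - Λ.G, by omega⟩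
          exact step (jb₂ k (by omega) i (by rw [← hG']; exact h')) ((mem _ _).2 ⟨hk, h⟩)
            (Or.inr (.track _ _)) (by simp)
    rintro ⟨k, l⟩ hv
    have hv : (k, l) ∈ S := by simpa using hv
    obtain ⟨hk, hl⟩ := (mem _ _).1 hv
    cases l with
    | r => exact jr k hk
    | p => exact step (jz k hk) hv (Or.inl (.static _ (.pz _))) (by simp)
    | c =>
      by_cases h : k % Λ.G = 0 ∧ k / Λ.G < Λ.m
      · obtain ⟨g, hg, hit⟩ := hf _ h.2
        -- The cell of the satisfying group `g` in the column of the clause.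
        have hmod : (g + Λ.G * (k / Λ.G)) % Λ.G = g := by
          rw [Nat.add_mul_mod_self_left, Nat.mod_eq_of_lt hg]
        have hdiv : (g + Λ.G * (k / Λ.G)) / Λ.G = k / Λ.G := by
          rw [Nat.add_mul_div_left _ _ hG, Nat.div_eq_of_lt hg, zero_add]
        have hlt : g + Λ.G * (k / Λ.G) < Λ.numCells := by
          unfold numCells
          nlinarith [h.2]
        exact step (jz _ hlt) hv (Or.inl (.clause _ _ _ h.1 h.2 hdiv (by rw [hmod]; exact hit)))
          (by simp)
      · exact step (jr k hk) hv (Or.inl (.free _ h)) (by simp)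
    | z β => obtain rfl := hl; exact jz k hk
    | q i =>
      by_cases h : Λ.W (f (k % Λ.G)) i = 1
      · exact step (js k hk i h) hv (Or.inl (.static _ (.qs _))) (by simp)
      · exact step (jb k hk i h) hv (Or.inl (.static _ (.qb _))) (by simp)
    | q' i =>
      by_cases h : Λ.W (f (k % Λ.G)) i = 1
      · exact step (js' k hk i h) hv (Or.inl (.static _ (.qs' _))) (by simp)
      · exact step (ja k hk i h) hv (Or.inl (.static _ (.qa _))) (by simp)
    | s i => exact js k hk i hl
    | b i => exact jb k hk i hl
    | s' i => exact js' k hk i hl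
    | a i => exact ja k hk i hl

end Layout

/-! ### Words of the same type -/

/-- There are at most `(t + 1) ^ 2` pairs (number of 0s, number of 2s), so by pigeonhole some pair
is shared by `2 ^ t₀` words. For these, an inclusion between the sets of 0s or of 2s is an equality
of sets of equal size. -/
theorem exists_separated (h : 2 ^ t₀ * (t + 1) ^ 2 ≤ 3 ^ t) :
    ∃ W : (Fin t₀ → Bool) → Fin t → Fin 3, Layout.Separated W := by
  let zeros : (Fin t → Fin 3) → Finset (Fin t) := fun w => Finset.univ.filter fun i => w i = 0
  let twos : (Fin t → Fin 3) → Finset (Fin t) := fun w => Finset.univ.filter fun i => w i = 2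
  have hlt : ∀ s : Finset (Fin t), s.card < t + 1 := fun s =>
    Nat.lt_succ_of_le (s.card_le_univ.trans (by simp))
  obtain ⟨y, -, hy⟩ := Finset.exists_le_card_fiber_of_mul_le_card_of_maps_to
    (s := (Finset.univ : Finset (Fin t → Fin 3)))
    (t := Finset.range (t + 1) ×ˢ Finset.range (t + 1)) (n := 2 ^ t₀)
    (f := fun w => ((zeros w).card, (twos w).card))
    (fun w _ => by simp only [Finset.mem_product, Finset.mem_range]; exact ⟨hlt _, hlt _⟩)
    ⟨(0, 0), by simp⟩ (by simpa [mul_comm, sq] using h)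
  obtain ⟨W⟩ : Nonempty ((Fin t₀ → Bool) ↪
      {w // w ∈ Finset.univ.filter fun w => ((zeros w).card, (twos w).card) = y}) := by
    rw [Function.Embedding.nonempty_iff_card_le, Fintype.card_coe]
    simpa using hy
  have hc : ∀ α, (zeros (W α)).card = y.1 ∧ (twos (W α)).card = y.2 := fun α => by
    have := (Finset.mem_filter.1 (W α).2).2
    exact ⟨congrArg Prod.fst this, congrArg Prod.snd this⟩
  refine ⟨fun α => W α, fun α β h₀ h₂ => W.injective (Subtype.ext (funext fun i => ?_))⟩
  have e₀ : zeros (W α) = zeros (W β) := Finset.eq_of_subset_of_card_le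
    (fun i hi => by simpa [zeros] using h₀ i (by simpa [zeros] using hi))
    (by rw [(hc α).1, (hc β).1])
  have e₂ : twos (W β) = twos (W α) := Finset.eq_of_subset_of_card_le
    (fun i hi => by simpa [twos] using h₂ i (by simpa [twos] using hi))
    (by rw [(hc α).2, (hc β).2])
  have i₀ : (W α : Fin t → Fin 3) i = 0 ↔ (W β : Fin t → Fin 3) i = 0 := by
    simpa [zeros] using Finset.ext_iff.1 e₀ i
  have i₂ : (W β : Fin t → Fin 3) i = 2 ↔ (W α : Fin t → Fin 3) i = 2 := by
    simpa [twos] using Finset.ext_iff.1 e₂ i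
  have three : ∀ x y : Fin 3, (x = 0 ↔ y = 0) → (y = 2 ↔ x = 2) → x = y := by decide
  exact three _ _ i₀ i₂

/-! ### The Steiner Tree instance -/

/-- The number of vertices of a cell. -/
def cellSize (t₀ t : ℕ) : ℕ := Fintype.card (Loc t₀ t)

/-- A numbering of the vertices of a cell. -/
noncomputable def Loc.code : Loc t₀ t ≃ Fin (cellSize t₀ t) := Fintype.equivFin _

theorem cellSize_pos (t₀ t : ℕ) : 0 < cellSize t₀ t := Fintype.card_pos_iff.2 ⟨.r⟩

/-- The vertex with a given number. -/
noncomputable def decode (t₀ t : ℕ) (v : ℕ) : ℕ × Loc t₀ t :=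
  (v / cellSize t₀ t, Loc.code.symm ⟨v % cellSize t₀ t, Nat.mod_lt _ (cellSize_pos t₀ t)⟩)

theorem decode_injective : Function.Injective (decode t₀ t) := by
  intro u v h
  simp only [decode, Prod.mk.injEq, EmbeddingLike.apply_eq_iff_eq, Fin.mk.injEq] at h
  rw [← Nat.mod_add_div u (cellSize t₀ t), ← Nat.mod_add_div v (cellSize t₀ t), h.1, h.2]

theorem decode_encode (k : ℕ) (l : Loc t₀ t) :
    decode t₀ t (k * cellSize t₀ t + Loc.code l) = (k, l) := by
  have h := (Loc.code l).2
  have h1 : (k * cellSize t₀ t + Loc.code l) / cellSize t₀ t = k := by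
    rw [mul_comm, Nat.mul_add_div (cellSize_pos t₀ t), Nat.div_eq_of_lt h, add_zero]
  have h2 : (k * cellSize t₀ t + Loc.code l) % cellSize t₀ t = Loc.code l := by
    rw [mul_comm, Nat.mul_add_mod, Nat.mod_eq_of_lt h]
  simp only [decode, h1, Prod.mk.injEq, true_and]
  rw [Equiv.symm_apply_eq]
  exact Fin.ext h2

namespace Layout

variable (Λ : Layout t₀ t)

open Classical in
/-- The Steiner Tree instance. -/
noncomputable def inst : STInstance where
  n := Λ.numCells * cellSize t₀ t
  graph := Λ.graph.comap fun v => decode t₀ t v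
  terminals := Finset.univ.filter fun v => (decode t₀ t v).2.IsTerminal
  budget := Λ.numCells * numClasses t₀ t

variable {Λ}

theorem decode_fst_lt (v : Fin Λ.inst.n) : (decode t₀ t v).1 < Λ.numCells :=
  Nat.div_lt_of_lt_mul (by rw [mul_comm]; exact v.2)

theorem mem_terminals {v : Fin Λ.inst.n} :
    v ∈ Λ.inst.terminals ↔ (decode t₀ t v).2.IsTerminal := by
  unfold inst at v ⊢
  simp

/-- The numbering of the vertices of the gadget graph as an embedding. -/
noncomputable def emb (Λ : Layout t₀ t) : Fin Λ.inst.n ↪ ℕ × Loc t₀ t where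
  toFun v := decode t₀ t v
  inj' _ _ h := Fin.ext (decode_injective h)

theorem exists_emb_eq {k : ℕ} (hk : k < Λ.numCells) (l : Loc t₀ t) : ∃ v, Λ.emb v = (k, l) := by
  refine ⟨⟨k * cellSize t₀ t + Loc.code l, ?_⟩, decode_encode k l⟩
  have h := (Loc.code l).2
  change _ < Λ.numCells * cellSize t₀ t
  nlinarith

/-- Corresponding sets of vertices induce isomorphic graphs. -/
noncomputable def induceIso (S : Finset (Fin Λ.inst.n)) :
    Λ.inst.graph.induce (S : Set (Fin Λ.inst.n)) ≃g
      Λ.graph.induce (S.map Λ.emb : Set (ℕ × Loc t₀ t)) where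
  toEquiv := (Equiv.Set.image Λ.emb S Λ.emb.injective).trans
    (Equiv.setCongr (Finset.coe_map _ _).symm)
  map_rel_iff' := Iff.rfl

theorem isSolution_map_iff {S : Finset (Fin Λ.inst.n)} : Λ.IsSolution (S.map Λ.emb) ↔
    S.card ≤ Λ.inst.budget ∧ Λ.inst.terminals ⊆ S ∧
      (Λ.inst.graph.induce (S : Set (Fin Λ.inst.n))).Connected := by
  constructor
  · intro h
    refine ⟨(Finset.card_map Λ.emb).symm.le.trans h.card_le, fun v hv => ?_, (induceIso S).connected_iff.2 h.connected⟩
    have := h.terminal (Λ.emb v).1 (decode_fst_lt v) (Λ.emb v).2 (mem_terminals.1 hv)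
    simpa using this
  · rintro ⟨h₁, h₂, h₃⟩
    refine ⟨?_, (Finset.card_map Λ.emb).le.trans h₁, ?_, (induceIso S).connected_iff.1 h₃⟩
    · intro v hv
      obtain ⟨u, -, rfl⟩ := Finset.mem_map.1 hv
      exact Finset.mem_product.2 ⟨Finset.mem_range.2 (decode_fst_lt u), Finset.mem_univ _⟩
    · intro k hk l hl
      obtain ⟨v, hv⟩ := exists_emb_eq hk l
      rw [← hv, Finset.mem_map' Λ.emb]
      refine h₂ (mem_terminals.2 ?_)
      rw [show decode t₀ t v = (k, l) from hv]
      exact hl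

theorem hasSteinerTree_inst_iff (hW : Separated Λ.W) (hG : 0 < Λ.G) :
    Λ.inst.HasSteinerTree ↔
      ∃ f : ℕ → Fin t₀ → Bool, ∀ j < Λ.m, ∃ g < Λ.G, Λ.hit j g (f g) := by
  constructor
  · rintro ⟨S, h⟩
    exact (isSolution_map_iff.2 h).exists_hit hW hG
  · rintro ⟨f, hf⟩
    obtain ⟨S, hS⟩ := exists_isSolution hG hf
    have : (S.preimage Λ.emb Λ.emb.injective.injOn).map Λ.emb = S := by
      refine Finset.ext fun v => ?_
      simp only [Finset.mem_map, Finset.mem_preimage]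
      refine ⟨fun ⟨u, hu, e⟩ => e ▸ hu, fun hv => ?_⟩
      obtain ⟨u, hu⟩ := exists_emb_eq (hS.lt_numCells (k := v.1) (l := v.2) hv) v.2
      exact ⟨u, hu ▸ hv, hu⟩
    exact ⟨_, isSolution_map_iff.1 (this.symm ▸ hS)⟩

/-! ### The cutwidth of the instance -/

/-- The edges that can cross a cut at cell `k₀`. The function `gr` lists the groups that can
satisfy a clause. -/
def crossing (Λ : Layout t₀ t) {d : ℕ} (gr : ℕ → Fin d → ℕ) (k₀ : ℕ) :
    Finset (Sym2 (ℕ × Loc t₀ t)) :=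
  (Finset.univ.image fun l : Loc t₀ t × Loc t₀ t => s((k₀, l.1), (k₀, l.2))) ∪
  (({k₀ - 1, k₀} : Finset ℕ).image fun k => s((k, .r), (k + 1, .r))) ∪
  ((Finset.range (Λ.G + 1) ×ˢ Finset.univ).image fun x : ℕ × Fin t =>
    s((k₀ - x.1, .b x.2), (k₀ - x.1 + Λ.G, .a x.2))) ∪
  (Finset.univ.image fun x : Fin d × (Fin t₀ → Bool) =>
    s((Λ.G * (k₀ / Λ.G), .c), (gr (k₀ / Λ.G) x.1 + Λ.G * (k₀ / Λ.G), .z x.2)))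

theorem card_crossing_le {d : ℕ} (gr : ℕ → Fin d → ℕ) (k₀ : ℕ) : (crossing Λ gr k₀).card ≤
    cellSize t₀ t * cellSize t₀ t + 2 + (Λ.G + 1) * t + d * 2 ^ t₀ := by
  unfold crossing
  refine (Finset.card_union_le _ _).trans (Nat.add_le_add ((Finset.card_union_le _ _).trans
    (Nat.add_le_add ((Finset.card_union_le _ _).trans (Nat.add_le_add ?_ ?_)) ?_)) ?_)
  · refine Finset.card_image_le.trans ?_
    simp [cellSize]
  · exact Finset.card_image_le.trans Finset.card_le_two
  · refine Finset.card_image_le.trans ?_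
    simp
  · refine Finset.card_image_le.trans ?_
    simp

/-- Cells are intervals of the arrangement, so an edge across a cut inside cell `k₀` joins cells `k
≤ k₀ ≤ k'`. Root edges start at `k₀ - 1` or `k₀`, track edges at most `G` cells before `k₀`, and
clause edges stay in the column of `k₀`, where `gr` leaves only `d` groups. -/
theorem mem_crossing {d : ℕ} {gr : ℕ → Fin d → ℕ} (hG : 0 < Λ.G)
    (hgr : ∀ j g α, Λ.hit j g α → ∃ e, g = gr j e) {k k₀ k' : ℕ} {l l' : Loc t₀ t}
    (h : Λ.Link k l k' l' ∨ Λ.Link k' l' k l) (hk : k ≤ k₀) (hk' : k₀ ≤ k') :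
    s((k, l), (k', l')) ∈ crossing Λ gr k₀ := by
  have same : ∀ {k l l'}, k ≤ k₀ → k₀ ≤ k → s((k, l), (k, l')) ∈ crossing Λ gr k₀ := by
    intro k l l' hk hk'
    obtain rfl := le_antisymm hk hk'
    simp only [crossing, Finset.mem_union]
    exact Or.inl (Or.inl (Or.inl (Finset.mem_image.2 ⟨(l, l'), Finset.mem_univ _, rfl⟩)))
  have clause : ∀ {k k' α}, k % Λ.G = 0 → k' / Λ.G = k / Λ.G → Λ.hit (k / Λ.G) (k' % Λ.G) α →
      k₀ / Λ.G = k / Λ.G → s((k, .c), (k', .z α)) ∈ crossing Λ gr k₀ := by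
    intro k k' α h₀ hk h h'
    obtain ⟨e, he⟩ := hgr _ _ _ h
    simp only [crossing, Finset.mem_union]
    refine Or.inr (Finset.mem_image.2 ⟨(e, α), Finset.mem_univ _, ?_⟩)
    have h1 : Λ.G * (k / Λ.G) = k := by
      have := Nat.mod_add_div k Λ.G
      omega
    have h2 : gr (k / Λ.G) e + k = k' := by
      rw [← he, ← h1, ← hk, Nat.mod_add_div]
    simp only [h', h1, h2]
  rcases h with h | h
  · cases h with
    | static => exact same hk hk'
    | first => exact same hk hk'
    | last => exact same hk hk'
    | free => exact same hk hk'
    | root =>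
      simp only [crossing, Finset.mem_union]
      exact Or.inl (Or.inl (Or.inr (Finset.mem_image.2 ⟨k, by simp; omega, rfl⟩)))
    | track i =>
      simp only [crossing, Finset.mem_union]
      refine Or.inl (Or.inr (Finset.mem_image.2 ⟨(k₀ - k, i), by simp; omega, ?_⟩))
      simp only [Nat.sub_sub_self hk]
    | clause _ α h₀ hm h₁ h₂ =>
      refine clause h₀ h₁ h₂ (le_antisymm ?_ (Nat.div_le_div_right hk))
      rw [← h₁]
      exact Nat.div_le_div_right hk'
  · cases h with
    | static => exact same hk hk'
    | first => exact same hk hk'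
    | last => exact same hk hk'
    | free => exact same hk hk'
    | root => omega
    | track i => omega
    | clause _ α h₀ hm h₁ h₂ =>
      rw [Sym2.eq_swap]
      refine clause h₀ h₁ h₂ (le_antisymm (Nat.div_le_div_right hk') ?_)
      rw [← h₁]
      exact Nat.div_le_div_right hk

/-- Only the track edges contribute a term that grows with the number of groups; their coefficient
`t` is what the choice of parameters has to match. -/
theorem arrangementCutwidth_inst_le {d : ℕ} {gr : ℕ → Fin d → ℕ} (hG : 0 < Λ.G)
    (hgr : ∀ j g α, Λ.hit j g α → ∃ e, g = gr j e) :
    arrangementCutwidth Λ.inst.graph (Equiv.refl (Fin Λ.inst.n)) ≤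
      cellSize t₀ t * cellSize t₀ t + 2 + (Λ.G + 1) * t + d * 2 ^ t₀ := by
  refine Finset.sup_le fun i _ => ?_
  rw [← Set.ncard_image_of_injective _ (Sym2.map.injective Λ.emb.injective)]
  refine le_trans (Set.ncard_le_ncard (t := crossing Λ gr (i / cellSize t₀ t)) ?_
    (Finset.finite_toSet _)) (by rw [Set.ncard_coe_finset]; exact card_crossing_le gr _)
  rintro _ ⟨_, ⟨he, u, v, hu, hv, rfl⟩, rfl⟩
  have hadj : Λ.graph.Adj (Λ.emb u) (Λ.emb v) := he
  exact mem_crossing hG hgr (adj_iff.1 hadj).2 (Nat.div_le_div_right hu)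
    (Nat.div_le_div_right hv.le)

end Layout

/-! ### The gadget graph of a formula -/

/-- The layout for a formula, with the variables grouped into blocks of `t₀` variables. -/
def satLayout (W : (Fin t₀ → Bool) → Fin t → Fin 3) (φ : CNF d) : Layout t₀ t where
  W := W
  -- Adding one covers an incomplete last block and keeps `G` positive when there are no variables.
  G := φ.numVars / t₀ + 1
  m := φ.clauses.length
  hit j g α := ∃ c, φ.clauses[j]? = some c ∧ ∃ l ∈ c, ∃ i : Fin t₀,
    (l.1 : ℕ) = g * t₀ + i ∧ l.2 = α i

theorem exists_hit_iff_satisfiable (W : (Fin t₀ → Bool) → Fin t → Fin 3) (φ : CNF d)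
    (ht : 0 < t₀) : (∃ f : ℕ → Fin t₀ → Bool, ∀ j < (satLayout W φ).m,
      ∃ g < (satLayout W φ).G, (satLayout W φ).hit j g (f g)) ↔ φ.Satisfiable := by
  constructor
  · rintro ⟨f, hf⟩
    refine ⟨fun v => f (v / t₀) ⟨v % t₀, Nat.mod_lt _ ht⟩, fun c hc => ?_⟩
    obtain ⟨j, hj, rfl⟩ := List.mem_iff_getElem.1 hc
    obtain ⟨g, -, c, hc, l, hl, i, h₁, h₂⟩ := hf j hj
    obtain rfl : φ.clauses[j] = c := by simpa [hj] using hc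
    refine ⟨l, hl, ?_⟩
    have e₁ : (l.1 : ℕ) / t₀ = g := by
      rw [h₁, mul_comm, Nat.mul_add_div ht, Nat.div_eq_of_lt i.2, add_zero]
    have e₂ : (l.1 : ℕ) % t₀ = i := by
      rw [h₁, mul_comm, Nat.mul_add_mod, Nat.mod_eq_of_lt i.2]
    simp only [e₁, e₂, h₂]
  · rintro ⟨a, ha⟩
    -- Places of the last block beyond `numVars` belong to no variable; their value is arbitrary.
    refine ⟨fun g i => if h : g * t₀ + i < φ.numVars then a ⟨_, h⟩ else false, fun j hj => ?_⟩
    obtain ⟨l, hl, h⟩ := ha φ.clauses[j] (List.getElem_mem hj)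
    have e : (l.1 : ℕ) / t₀ * t₀ + (l.1 : ℕ) % t₀ = l.1 := by
      rw [mul_comm]; exact Nat.div_add_mod _ _
    refine ⟨l.1 / t₀, Nat.lt_succ_of_le (Nat.div_le_div_right l.1.2.le), φ.clauses[j],
      List.getElem?_eq_getElem hj, l, hl, ⟨l.1 % t₀, Nat.mod_lt _ ht⟩, e.symm, ?_⟩
    simp only [e]
    rw [dif_pos l.1.2, ← h]

/-- A clause has at most `d` literals and can be satisfied only by the blocks of their variables:
`gr j e` is the block of the `e`-th literal, with a junk value where there is none. -/
theorem exists_groups (W : (Fin t₀ → Bool) → Fin t → Fin 3) (φ : CNF d) :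
    ∃ gr : ℕ → Fin d → ℕ, ∀ j g α, (satLayout W φ).hit j g α → ∃ e, g = gr j e := by
  refine ⟨fun j e => (((φ.clauses[j]?.getD [])[(e : ℕ)]?).map fun l => (l.1 : ℕ) / t₀).getD 0, ?_⟩
  rintro j g α ⟨c, hc, l, hl, i, h, -⟩
  obtain ⟨e, he, rfl⟩ := List.mem_iff_getElem.1 hl
  have hd := φ.width_le c (List.mem_of_getElem? hc)
  refine ⟨⟨e, he.trans_le hd⟩, ?_⟩
  have ht : 0 < t₀ := i.pos
  simp only [hc, Option.getD_some, List.getElem?_eq_getElem he, Option.map_some, h]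
  rw [mul_comm, Nat.mul_add_div ht, Nat.div_eq_of_lt i.2, add_zero]

/-! ### The encoding of a formula -/

/-- The position of a clause in the encoding of the formula. -/
def CNF.offset (φ : CNF d) (j : ℕ) : ℕ :=
  2 + ((φ.clauses.take j).map fun c => c.length + 1).sum

theorem CNF.drop_offset (φ : CNF d) (j : ℕ) : φ.encode.drop (φ.offset j) =
    (φ.clauses.drop j).flatMap fun c => c.length :: c.map fun l => 2 * (l.1 : ℕ) + l.2.toNat := by
  unfold CNF.offset CNF.encode
  rw [add_comm, List.drop_succ_cons, List.drop_succ_cons]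
  generalize φ.clauses = cs
  induction cs generalizing j with
  | nil => simp
  | cons c cs ih =>
    cases j with
    | zero => simp
    | succ j =>
      rw [List.take_succ_cons, List.map_cons, List.sum_cons, List.flatMap_cons, List.drop_succ_cons,
        ← ih j, ← List.drop_drop]
      congr 1
      exact List.drop_left' (by simp)

theorem CNF.getD_offset (φ : CNF d) {j : ℕ} {cl : List (Fin φ.numVars × Bool)}
    (hc : φ.clauses[j]? = some cl) : φ.encode.getD (φ.offset j) 0 = cl.length ∧
      ∀ e (he : e < cl.length),
        φ.encode.getD (φ.offset j + 1 + e) 0 = 2 * (cl[e].1 : ℕ) + cl[e].2.toNat := by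
  obtain ⟨hj, rfl⟩ := List.getElem?_eq_some_iff.1 hc
  have h := φ.drop_offset j
  rw [List.drop_eq_getElem_cons hj, List.flatMap_cons] at h
  have key : ∀ x, φ.encode.getD (φ.offset j + x) 0 = (φ.encode.drop (φ.offset j)).getD x 0 :=
    fun x => by simp [List.getD_eq_getElem?_getD]
  constructor
  · rw [← Nat.add_zero (φ.offset j), key, h]
    simp
  · intro e he
    rw [add_assoc, key, h, add_comm 1 e]
    simp [List.getD_eq_getElem?_getD, List.getElem?_append_left, he]

/-- This recurrence lets the machine locate all clauses in one pass, by reading the length stored at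
the start of each. -/
theorem CNF.offset_succ (φ : CNF d) {j : ℕ} (hj : j < φ.clauses.length) :
    φ.offset (j + 1) = φ.offset j + 1 + φ.encode.getD (φ.offset j) 0 := by
  rw [(φ.getD_offset (List.getElem?_eq_getElem hj)).1]
  unfold CNF.offset
  rw [List.take_succ_eq_append_getElem hj, List.map_append, List.sum_append]
  simp only [List.map_cons, List.map_nil, List.sum_singleton]
  omega

theorem CNF.length_encode (φ : CNF d) : φ.encode.length = φ.offset φ.clauses.length := by
  simp [CNF.encode, CNF.offset, List.length_flatMap]
  omega

theorem CNF.offset_mono (φ : CNF d) : Monotone φ.offset := by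
  refine monotone_nat_of_le_succ fun j => ?_
  by_cases hj : j < φ.clauses.length
  · rw [φ.offset_succ hj]; omega
  · unfold CNF.offset
    rw [List.take_of_length_le (by omega), List.take_of_length_le (by omega)]

theorem CNF.offset_le (φ : CNF d) {j : ℕ} (hj : j ≤ φ.clauses.length) :
    φ.offset j ≤ φ.encode.length :=
  φ.length_encode ▸ φ.offset_mono hj

theorem length_le_inputSize (w : List ℕ) : w.length ≤ inputSize w := by
  induction w with
  | nil => simp
  | cons a w ih => simp only [inputSize, List.map_cons, List.sum_cons, List.length_cons] at ih ⊢; omega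

theorem size_getD_le_inputSize (w : List ℕ) (i : ℕ) : Nat.size (w.getD i 0) ≤ inputSize w := by
  induction w generalizing i with
  | nil => simp
  | cons a w ih =>
    cases i with
    | zero => simp [inputSize]; omega
    | succ i =>
      have := ih i
      simp only [inputSize, List.map_cons, List.sum_cons, List.getD_cons_succ] at this ⊢
      omega

theorem CNF.length_clauses_le (φ : CNF d) : φ.clauses.length ≤ inputSize φ.encode := by
  refine le_trans ?_ (length_le_inputSize _)
  rw [φ.length_encode]
  have : ∀ j ≤ φ.clauses.length, j ≤ φ.offset j := by
    intro j
    induction j with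
    | zero => simp
    | succ j ih =>
      intro hj
      rw [φ.offset_succ (by omega)]
      have := ih (by omega)
      omega
  exact this _ le_rfl

/-! ### Logical expressions -/

namespace Expr

/-- The expression, read as a truth value, is true. -/
def Holds (e : Expr) (A : ℕ → ℕ → ℕ) (x : ℕ) : Prop := e.eval A x ≠ 0

/-- Sum. -/
def add (e f : Expr) : Expr := .op .add e f

/-- Truncated difference. -/
def sub (e f : Expr) : Expr := .op .sub e f

/-- Product. -/
def mul (e f : Expr) : Expr := .op .mul e f

/-- Quotient. -/
def div (e f : Expr) : Expr := .op .div e f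

/-- Remainder. -/
def mod (e f : Expr) : Expr := e.sub (f.mul (e.div f))

/-- Negation. -/
def not (e : Expr) : Expr := (const 1).sub e

/-- Conjunction. -/
def and (e f : Expr) : Expr := e.mul f

/-- Disjunction. -/
def or (e f : Expr) : Expr := e.add f

/-- Inequality. -/
def ne (e f : Expr) : Expr := (e.sub f).add (f.sub e)

/-- Equality. -/
def eq (e f : Expr) : Expr := (e.ne f).not

/-- Strict comparison. -/
def lt (e f : Expr) : Expr := f.sub e

/-- Disjunction over a finite set. -/
noncomputable def any {ι : Type*} (s : Finset ι) (f : ι → Expr) : Expr :=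
  s.toList.foldr (fun i e => (f i).or e) (const 0)

/-- Case distinction. -/
def ite (c e f : Expr) : Expr := (c.not.not.mul e).add (c.not.mul f)

variable {A : ℕ → ℕ → ℕ} {x : ℕ} {e f : Expr}

@[simp] theorem eval_idx : idx.eval A x = x := rfl
@[simp] theorem eval_const (c : ℕ) : (const c).eval A x = c := rfl
@[simp] theorem eval_read (a : ℕ) : (read a e).eval A x = A a (e.eval A x) := rfl
@[simp] theorem eval_add : (e.add f).eval A x = e.eval A x + f.eval A x := rfl
@[simp] theorem eval_sub : (e.sub f).eval A x = e.eval A x - f.eval A x := rfl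
@[simp] theorem eval_mul : (e.mul f).eval A x = e.eval A x * f.eval A x := rfl
@[simp] theorem eval_div : (e.div f).eval A x = e.eval A x / f.eval A x := rfl

@[simp] theorem eval_mod : (e.mod f).eval A x = e.eval A x % f.eval A x := by
  simp only [mod, eval_sub, eval_mul, eval_div]
  have := Nat.mod_add_div (e.eval A x) (f.eval A x)
  omega

@[simp] theorem holds_not : e.not.Holds A x ↔ ¬ e.Holds A x := by
  simp [Holds, not]; omega

@[simp] theorem holds_and : (e.and f).Holds A x ↔ e.Holds A x ∧ f.Holds A x := by
  simp [Holds, and]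

@[simp] theorem holds_or : (e.or f).Holds A x ↔ e.Holds A x ∨ f.Holds A x := by
  simp [Holds, or]; omega

@[simp] theorem holds_ne : (e.ne f).Holds A x ↔ e.eval A x ≠ f.eval A x := by
  simp [Holds, ne]; omega

@[simp] theorem holds_eq : (e.eq f).Holds A x ↔ e.eval A x = f.eval A x := by
  simp [eq]

@[simp] theorem holds_lt : (e.lt f).Holds A x ↔ e.eval A x < f.eval A x := by
  simp [Holds, lt]; omega

@[simp] theorem holds_any {ι : Type*} {s : Finset ι} {f : ι → Expr} :
    (any s f).Holds A x ↔ ∃ i ∈ s, (f i).Holds A x := by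
  have : ∀ l : List ι, (l.foldr (fun i e => (f i).or e) (const 0)).Holds A x ↔
      ∃ i ∈ l, (f i).Holds A x := by
    intro l
    induction l with
    | nil => simp [Holds]
    | cons i l ih => simp [ih]
  unfold any
  simpa using this s.toList

-- Any nonzero number counts as true, so the double negation in `ite` is needed to normalise the
-- condition to 0 or 1. Both branches are evaluated, which is harmless since expressions are total.
open Classical in
theorem eval_ite (c : Expr) :
    (ite c e f).eval A x = if c.Holds A x then e.eval A x else f.eval A x := by
  by_cases h : c.eval A x = 0
  · simp [ite, not, Holds, h]
  · have : 1 - c.eval A x = 0 := by omega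
    simp [ite, not, Holds, h, this]

end Expr

/-! ### Adjacency as an expression -/

namespace Expr

/-- The number of groups. -/
def numGroups (t₀ : ℕ) : Expr := ((read 0 (const 0)).div (const t₀)).add (const 1)

/-- The number of cells. -/
def numCells (t₀ : ℕ) : Expr := ((read 0 (const 1)).add (const 1)).mul (numGroups t₀)

/-- The cell of a vertex. -/
def cell (t₀ t : ℕ) (u : Expr) : Expr := u.div (const (cellSize t₀ t))

/-- The vertex has the given place in its cell. -/
noncomputable def isLoc (u : Expr) (l : Loc t₀ t) : Expr :=
  (u.mod (const (cellSize t₀ t))).eq (const (Loc.code l))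

/-- The assignment `α` of the group `g` satisfies the clause `j`. -/
noncomputable def hit (d : ℕ) (j g : Expr) (α : Fin t₀ → Bool) : Expr :=
  any (Finset.univ : Finset (Fin d × Fin t₀)) fun y =>
    ((const y.1).lt (read 0 (read 1 j))).and
      ((read 0 (((read 1 j).add (const 1)).add (const y.1))).eq
        (((const 2).mul ((g.mul (const t₀)).add (const y.2))).add (const (α y.2).toNat)))

open Classical in
/-- There is an edge from `u` to `v`. -/
noncomputable def link (d : ℕ) (W : (Fin t₀ → Bool) → Fin t → Fin 3) (u v : Expr) : Expr :=
  let k := cell t₀ t u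
  let k' := cell t₀ t v
  let G := numGroups t₀
  let m := read 0 (const 1)
  let root : Loc t₀ t := .r
  (((k.eq k').and
    (((any (Finset.univ.filter fun y : Loc t₀ t × Loc t₀ t => Static W y.1 y.2)
        fun y => (u.isLoc y.1).and (v.isLoc y.2)).or
      ((k.lt G).and ((any Finset.univ fun i => u.isLoc (.a i : Loc t₀ t)).and (v.isLoc root)))).or
      (((k.lt (m.mul G)).not.and
          ((any Finset.univ fun i => u.isLoc (.b i : Loc t₀ t)).and (v.isLoc root))).or
        (((((k.mod G).eq (const 0)).and ((k.div G).lt m)).not).and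
          ((u.isLoc (.c : Loc t₀ t)).and (v.isLoc root)))))).or
  (((k.add (const 1)).eq k').and ((u.isLoc root).and (v.isLoc root)))).or
  ((((k.add G).eq k').and
    (any Finset.univ fun i => (u.isLoc (.b i : Loc t₀ t)).and (v.isLoc (.a i : Loc t₀ t)))).or
  (((((k.mod G).eq (const 0)).and ((k.div G).lt m)).and ((k'.div G).eq (k.div G))).and
    ((u.isLoc (.c : Loc t₀ t)).and
      (any Finset.univ fun α => (v.isLoc (.z α : Loc t₀ t)).and (hit d (k.div G) (k'.mod G) α)))))

/-- The vertices `u` and `v` are adjacent. -/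
noncomputable def adj (d : ℕ) (W : (Fin t₀ → Bool) → Fin t → Fin 3) (u v : Expr) : Expr :=
  (u.ne v).and ((link d W u v).or (link d W v u))

open Classical in
/-- The vertex `u` is a terminal. -/
noncomputable def isTerminal (t₀ t : ℕ) (u : Expr) : Expr :=
  any (Finset.univ.filter fun l : Loc t₀ t => l.IsTerminal) fun l => u.isLoc l

/-- The arrays hold the formula and the positions of its clauses. -/
structure Prepared (φ : CNF d) (A : ℕ → ℕ → ℕ) : Prop where
  input : ∀ i, A 0 i = φ.encode.getD i 0
  offset : ∀ j < φ.clauses.length, A 1 j = φ.offset j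

variable {φ : CNF d} {A : ℕ → ℕ → ℕ} {x : ℕ} {W : (Fin t₀ → Bool) → Fin t → Fin 3}

theorem Prepared.input_zero (hA : Prepared φ A) : A 0 0 = φ.numVars := hA.input 0

theorem Prepared.input_one (hA : Prepared φ A) : A 0 1 = φ.clauses.length := hA.input 1

theorem eval_numGroups (W : (Fin t₀ → Bool) → Fin t → Fin 3) (hA : Prepared φ A) :
    (numGroups t₀).eval A x = (satLayout W φ).G := by
  simp [numGroups, hA.input_zero, satLayout]

theorem eval_numCells (W : (Fin t₀ → Bool) → Fin t → Fin 3) (hA : Prepared φ A) :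
    (numCells t₀).eval A x = (satLayout W φ).numCells := by
  simp [numCells, eval_numGroups W hA, hA.input_one, Layout.numCells, satLayout]

theorem eval_cell {u : Expr} : (cell t₀ t u).eval A x = (decode t₀ t (u.eval A x)).1 := rfl

theorem holds_isLoc {u : Expr} {l : Loc t₀ t} :
    (u.isLoc l).Holds A x ↔ (decode t₀ t (u.eval A x)).2 = l := by
  simp [isLoc, decode, Equiv.symm_apply_eq, Fin.ext_iff]

/-- The condition `hj` is needed because array `1` is specified only at existing clauses. -/
theorem holds_hit (hA : Prepared φ A) {j g : Expr} (hj : j.eval A x < φ.clauses.length)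
    {α : Fin t₀ → Bool} : (hit d j g α).Holds A x ↔
      (satLayout W φ).hit (j.eval A x) (g.eval A x) α := by
  obtain ⟨h₁, h₂⟩ := φ.getD_offset (List.getElem?_eq_getElem hj)
  have hd := φ.width_le _ (List.getElem_mem hj)
  simp only [hit, holds_any, Finset.mem_univ, true_and, holds_and, holds_lt, holds_eq, eval_const,
    eval_read, eval_add, eval_mul, hA.input, hA.offset _ hj, h₁, satLayout,
    List.getElem?_eq_getElem hj, Option.some.injEq, exists_eq_left', Prod.exists]
  have bit : ∀ (a b : ℕ) (p q : Bool), 2 * a + p.toNat = 2 * b + q.toNat ↔ a = b ∧ p = q := by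
    intro a b p q
    cases p <;> cases q <;> simp <;> omega
  constructor
  · rintro ⟨e, i, he, h⟩
    rw [h₂ e he, bit] at h
    exact ⟨_, _, List.getElem_mem he, i, h⟩
  · rintro ⟨l, b, hl, i, h⟩
    obtain ⟨e, he, hlb⟩ := List.mem_iff_getElem.1 hl
    refine ⟨⟨e, he.trans_le hd⟩, i, he, ?_⟩
    rw [h₂ e he, bit, hlb]
    exact h

theorem holds_link (hA : Prepared φ A) {u v : Expr} : (link d W u v).Holds A x ↔
    (satLayout W φ).Link (decode t₀ t (u.eval A x)).1 (decode t₀ t (u.eval A x)).2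
      (decode t₀ t (v.eval A x)).1 (decode t₀ t (v.eval A x)).2 := by
  -- The equivalence is claimed for existing clauses only; in `link` the subexpression `hit` stands
  -- behind a guard ensuring this.
  have hit_iff : ∀ α : Fin t₀ → Bool,
      (decode t₀ t (u.eval A x)).1 / (satLayout W φ).G < φ.clauses.length →
      ((hit d ((cell t₀ t u).div (numGroups t₀)) ((cell t₀ t v).mod (numGroups t₀)) α).Holds A x ↔
        (satLayout W φ).hit ((decode t₀ t (u.eval A x)).1 / (satLayout W φ).G)
          ((decode t₀ t (v.eval A x)).1 % (satLayout W φ).G) α) := by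
    intro α h
    rw [holds_hit (W := W) hA]
    · simp only [eval_div, eval_mod, eval_cell, eval_numGroups W hA]
    · simpa only [eval_div, eval_cell, eval_numGroups W hA] using h
  simp only [link, holds_or, holds_and, holds_any, holds_eq, holds_lt, holds_not, eval_add, eval_mul,
    eval_div, eval_mod, eval_const, eval_read, eval_cell, eval_numGroups W hA, hA.input_one,
    holds_isLoc, Finset.mem_filter, Finset.mem_univ, true_and, Prod.exists]
  generalize hU : decode t₀ t (u.eval A x) = U at hit_iff
  generalize hV : decode t₀ t (v.eval A x) = V at hit_iff
  obtain ⟨k, l⟩ := U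
  obtain ⟨k', l'⟩ := V
  simp only at hit_iff ⊢
  constructor
  · rintro ((⟨rfl, (⟨_, _, h, rfl, rfl⟩ | ⟨h, ⟨i, rfl⟩, rfl⟩) | ⟨h, ⟨i, rfl⟩, rfl⟩ |
      ⟨h, rfl, rfl⟩⟩ | ⟨rfl, rfl, rfl⟩) | ⟨rfl, i, rfl, rfl⟩ | ⟨⟨⟨h₀, hm⟩, hk⟩, rfl, α, rfl, h⟩)
    · exact .static _ h
    · exact .first _ _ h
    · exact .last _ _ (not_lt.1 h)
    · exact .free _ h
    · exact .root _
    · exact .track _ _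
    · exact .clause _ _ _ h₀ hm hk ((hit_iff _ hm).1 h)
  · intro h
    cases h with
    | static h => exact Or.inl (Or.inl ⟨rfl, Or.inl (Or.inl ⟨_, _, h, rfl, rfl⟩)⟩)
    | first _ h => exact Or.inl (Or.inl ⟨rfl, Or.inl (Or.inr ⟨h, ⟨_, rfl⟩, rfl⟩)⟩)
    | last _ h => exact Or.inl (Or.inl ⟨rfl, Or.inr (Or.inl ⟨not_lt.2 h, ⟨_, rfl⟩, rfl⟩)⟩)
    | free h => exact Or.inl (Or.inl ⟨rfl, Or.inr (Or.inr ⟨h, rfl, rfl⟩)⟩)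
    | root => exact Or.inl (Or.inr ⟨rfl, rfl, rfl⟩)
    | track i => exact Or.inr (Or.inl ⟨rfl, _, rfl, rfl⟩)
    | clause _ α h₀ hm hk h =>
      exact Or.inr (Or.inr ⟨⟨⟨h₀, hm⟩, hk⟩, rfl, _, rfl, (hit_iff _ hm).2 h⟩)

theorem holds_adj (hA : Prepared φ A) {u v : Expr} : (adj d W u v).Holds A x ↔
    (satLayout W φ).graph.Adj (decode t₀ t (u.eval A x)) (decode t₀ t (v.eval A x)) := by
  rw [Layout.adj_iff, decode_injective.ne_iff]
  simp [adj, holds_link hA]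

theorem holds_isTerminal {u : Expr} :
    (isTerminal t₀ t u).Holds A x ↔ (decode t₀ t (u.eval A x)).2.IsTerminal := by
  simp [isTerminal, holds_isLoc]

end Expr

/-! ### The encoding of the Steiner Tree instance, position by position -/

open Classical in
/-- The number at a position of the encoding of the Steiner Tree instance. -/
noncomputable def Layout.out (Λ : Layout t₀ t) (x : ℕ) : ℕ :=
  if x = 0 then Λ.inst.n else if x = 1 then Λ.inst.budget else
  if x < 2 + Λ.inst.n then if (decode t₀ t (x - 2)).2.IsTerminal then 1 else 0 else
  if x < 2 + Λ.inst.n + Λ.inst.n * Λ.inst.n then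
    if Λ.graph.Adj (decode t₀ t ((x - 2 - Λ.inst.n) / Λ.inst.n))
      (decode t₀ t ((x - 2 - Λ.inst.n) % Λ.inst.n)) then 1 else 0
  else x - 2 - Λ.inst.n - Λ.inst.n * Λ.inst.n

theorem map_finRange {α : Type*} (k : ℕ) (g : ℕ → α) :
    ((List.finRange k).map fun v : Fin k => g v) = (List.range k).map g :=
  List.ext_getElem (by simp) fun i _ _ => by simp

/-- Row-major order: a nested enumeration becomes a single one through quotient and remainder, so
one loop can write the adjacency matrix. -/
theorem flatMap_finRange {α : Type*} (n m : ℕ) (f : ℕ → ℕ → α) :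
    ((List.finRange n).flatMap fun u : Fin n => (List.finRange m).map fun v : Fin m => f u v) =
      (List.range (n * m)).map fun x => f (x / m) (x % m) := by
  simp only [map_finRange]
  rw [List.flatMap_def, map_finRange n fun u => (List.range m).map (f u)]
  induction n with
  | zero => simp
  | succ n ih =>
    rw [List.range_succ, List.map_append, List.flatten_append, ih, Nat.add_mul, one_mul,
      List.range_add, List.map_append]
    congr 1
    simp only [List.map_cons, List.map_nil, List.flatten_cons, List.flatten_nil, List.append_nil,
      List.map_map]
    refine List.map_congr_left fun i hi => ?_
    have hi : i < m := List.mem_range.1 hi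
    have hm : 0 < m := by omega
    simp only [Function.comp]
    rw [mul_comm, Nat.mul_add_div hm, Nat.div_eq_of_lt hi, add_zero, Nat.mul_add_mod,
      Nat.mod_eq_of_lt hi]

namespace Layout

variable (Λ : Layout t₀ t)

/-- The instance with the vertices arranged by their numbers. -/
noncomputable def arrangedInst : ArrangedSTInstance where
  toSTInstance := Λ.inst
  arrangement := Equiv.refl _

theorem encode_inst : Λ.inst.encode =
    (List.range (2 + Λ.inst.n + Λ.inst.n * Λ.inst.n)).map Λ.out := by
  classical
  have h1 : ((List.finRange Λ.inst.n).map fun v => if v ∈ Λ.inst.terminals then 1 else 0) =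
      (List.range Λ.inst.n).map fun x => Λ.out (2 + x) := by
    rw [← map_finRange]
    refine List.map_congr_left fun v _ => ?_
    have h : (v : ℕ) < Λ.inst.n := v.2
    have e1 : 2 + (v : ℕ) ≠ 1 := by omega
    simp [out, mem_terminals, h, e1]
  have h2 : ((List.finRange Λ.inst.n).flatMap fun u => (List.finRange Λ.inst.n).map fun v =>
      if Λ.inst.graph.Adj u v then 1 else 0) =
      (List.range (Λ.inst.n * Λ.inst.n)).map fun x => Λ.out (2 + Λ.inst.n + x) := by
    refine (flatMap_finRange _ _ fun u v =>
      if Λ.graph.Adj (decode t₀ t u) (decode t₀ t v) then 1 else 0).trans ?_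
    refine List.map_congr_left fun x hx => ?_
    have hx : x < Λ.inst.n * Λ.inst.n := List.mem_range.1 hx
    have e0 : 2 + Λ.inst.n + x ≠ 0 := by omega
    have e1 : 2 + Λ.inst.n + x ≠ 1 := by omega
    have e2 : ¬ 2 + Λ.inst.n + x < 2 + Λ.inst.n := by omega
    have e3 : 2 + Λ.inst.n + x - 2 - Λ.inst.n = x := by omega
    have e4 : 2 + Λ.inst.n + x < 2 + Λ.inst.n + Λ.inst.n * Λ.inst.n := by omega
    simp only [out, e0, e1, e2, e3, e4, if_false, if_true]
  rw [STInstance.encode, h1, h2, List.range_add, List.range_add]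
  simp only [List.map_append, List.map_map, Function.comp_def]
  simp [List.range_succ, out]

theorem encode_arrangedInst : Λ.arrangedInst.encode =
    (List.range (2 + Λ.inst.n + Λ.inst.n * Λ.inst.n + Λ.inst.n)).map Λ.out := by
  rw [ArrangedSTInstance.encode, List.range_add, List.map_append]
  refine congrArg₂ _ Λ.encode_inst ?_
  refine (map_finRange _ fun x => x).trans ?_
  rw [List.map_map]
  refine List.map_congr_left fun x hx => ?_
  change x = Λ.out (2 + Λ.inst.n + Λ.inst.n * Λ.inst.n + x)
  have e0 : 2 + Λ.inst.n + Λ.inst.n * Λ.inst.n + x ≠ 0 := by omega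
  have e1 : 2 + Λ.inst.n + Λ.inst.n * Λ.inst.n + x ≠ 1 := by omega
  have e2 : ¬ 2 + Λ.inst.n + Λ.inst.n * Λ.inst.n + x < 2 + Λ.inst.n := by omega
  have e3 : ¬ 2 + Λ.inst.n + Λ.inst.n * Λ.inst.n + x < 2 + Λ.inst.n + Λ.inst.n * Λ.inst.n := by
    omega
  simp only [out, e0, e1, e2, e3, if_false]
  omega

theorem numClasses_le : numClasses t₀ t ≤ cellSize t₀ t :=
  Finset.card_image_le

theorem out_le (x : ℕ) : Λ.out x ≤ Λ.inst.n + x + 1 := by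
  have : Λ.inst.budget ≤ Λ.inst.n := Nat.mul_le_mul_left _ numClasses_le
  unfold out
  split_ifs <;> omega

/-- The encoding of the instance without (`ρ = 0`) and with (`ρ = 1`) the arrangement. -/
noncomputable def outWord (ρ : ℕ) : List ℕ :=
  (List.range (2 + Λ.inst.n + Λ.inst.n * Λ.inst.n + ρ * Λ.inst.n)).map Λ.out

theorem outWord_zero : Λ.outWord 0 = Λ.inst.encode := by simp [outWord, encode_inst]

theorem outWord_one : Λ.outWord 1 = Λ.arrangedInst.encode := by simp [outWord, encode_arrangedInst]

end Layout

/-! ### The program of the reduction -/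

namespace Expr

/-- The number of vertices. -/
def numVertices (t₀ t : ℕ) : Expr := (numCells t₀).mul (const (cellSize t₀ t))

/-- The number at position `x` of the encoding of the Steiner Tree instance. -/
noncomputable def out (d : ℕ) (W : (Fin t₀ → Bool) → Fin t → Fin 3) : Expr :=
  let N := numVertices t₀ t
  let y := (idx.sub (const 2)).sub N
  ite (idx.eq (const 0)) N <| ite (idx.eq (const 1)) ((numCells t₀).mul (const (numClasses t₀ t))) <|
  ite (idx.lt ((const 2).add N))
    (ite (isTerminal t₀ t (idx.sub (const 2))) (const 1) (const 0)) <|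
  ite (idx.lt (((const 2).add N).add (N.mul N)))
    (ite (adj d W (y.div N) (y.mod N)) (const 1) (const 0)) <|
  y.sub (N.mul N)

/-- The length of the encoding. -/
noncomputable def outLength (t₀ t ρ : ℕ) : Expr :=
  let N := numVertices t₀ t
  (((const 2).add N).add (N.mul N)).add ((const ρ).mul N)

/-- The position of a clause in the encoding of the formula, computed from that of the previous
clause. -/
def offset : Expr :=
  ite (idx.eq (const 0)) (const 2)
    (((read 1 (idx.sub (const 1))).add (const 1)).add (read 0 (read 1 (idx.sub (const 1)))))

variable {φ : CNF d} {A : ℕ → ℕ → ℕ} {x : ℕ} {W : (Fin t₀ → Bool) → Fin t → Fin 3}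

theorem eval_numVertices (W : (Fin t₀ → Bool) → Fin t → Fin 3) (hA : Prepared φ A) :
    (numVertices t₀ t).eval A x = (satLayout W φ).inst.n := by
  simp [numVertices, eval_numCells W hA, Layout.inst]

theorem eval_out (hA : Prepared φ A) : (out d W).eval A x = (satLayout W φ).out x := by
  classical
  have hb : (satLayout W φ).inst.budget = (satLayout W φ).numCells * numClasses t₀ t := rfl
  simp only [out, eval_ite, holds_eq, holds_lt, holds_isTerminal, holds_adj hA, eval_idx,
    eval_const, eval_sub, eval_add, eval_mul, eval_div, eval_mod, eval_numVertices W hA,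
    eval_numCells W hA, Layout.out, hb]

theorem eval_outLength {ρ : ℕ} (W : (Fin t₀ → Bool) → Fin t → Fin 3) (hA : Prepared φ A) :
    (outLength t₀ t ρ).eval A x = ((satLayout W φ).outWord ρ).length := by
  simp [outLength, eval_numVertices W hA, Layout.outWord]

/-- Entry `x` is computed from entry `x - 1`, which the partly filled array already contains. -/
theorem eval_offset (φ : CNF d) {A : ℕ → ℕ → ℕ} (hA : ∀ i, A 0 i = φ.encode.getD i 0)
    {x : ℕ} (hx : x < φ.clauses.length) :
    offset.eval (fill A 1 φ.offset x) x = φ.offset x := by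
  classical
  simp only [offset, eval_ite, holds_eq, eval_idx, eval_const, eval_sub, eval_add, eval_read]
  cases x with
  | zero => simp [CNF.offset]
  | succ x =>
    rw [if_neg (by omega), φ.offset_succ (by omega)]
    simp [fill, hA]

end Expr

/-- The program that writes the encoded Steiner Tree instance to array `2`. -/
noncomputable def reduction (d : ℕ) (W : (Fin t₀ → Bool) → Fin t → Fin 3) (ρ : ℕ) : Prog :=
  .seq (forStore 1 (.read 0 (.const 1)) .offset)
    (forStore 2 (.outLength t₀ t ρ) (.out d W))

/-- A quantity in which the size of the instance and the time of the reduction are polynomial. -/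
def CNF.bulk (φ : CNF d) : ℕ := (φ.numVars + 1) * (inputSize φ.encode + 1)

/-- The number of cells grows with the number of variables itself, which the input gives only in
binary. This is why `CNF.bulk` has the factor `numVars + 1` and need not be polynomial in the input
size. -/
theorem numVertices_le (W : (Fin t₀ → Bool) → Fin t → Fin 3) (φ : CNF d) :
    (satLayout W φ).inst.n ≤ cellSize t₀ t * φ.bulk := by
  have h1 : φ.numVars / t₀ + 1 ≤ φ.numVars + 1 := Nat.succ_le_succ (Nat.div_le_self _ _)
  have h2 : φ.clauses.length + 1 ≤ inputSize φ.encode + 1 := Nat.succ_le_succ φ.length_clauses_le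
  calc (satLayout W φ).inst.n
      = (φ.clauses.length + 1) * (φ.numVars / t₀ + 1) * cellSize t₀ t := rfl
    _ ≤ (inputSize φ.encode + 1) * (φ.numVars + 1) * cellSize t₀ t := by gcongr
    _ = cellSize t₀ t * φ.bulk := by unfold CNF.bulk; ring

theorem CNF.bulk_pos (φ : CNF d) : 0 < φ.bulk := by unfold CNF.bulk; positivity

theorem length_outWord_le (W : (Fin t₀ → Bool) → Fin t → Fin 3) (φ : CNF d) {ρ : ℕ} (hρ : ρ ≤ 1) :
    ((satLayout W φ).outWord ρ).length ≤ (cellSize t₀ t + 2) ^ 2 * φ.bulk ^ 2 := by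
  have h := numVertices_le W φ
  have hb := φ.bulk_pos
  simp only [Layout.outWord, List.length_map, List.length_range]
  generalize (satLayout W φ).inst.n = N at h
  generalize cellSize t₀ t = B at h
  generalize φ.bulk = Y at h hb
  calc 2 + N + N * N + ρ * N ≤ 2 + N + N * N + 1 * N := by gcongr
    _ ≤ (N + 2) ^ 2 := by nlinarith
    _ ≤ (B * Y + 2 * Y) ^ 2 := by gcongr; omega
    _ = (B + 2) ^ 2 * Y ^ 2 := by ring

theorem out_le_length (W : (Fin t₀ → Bool) → Fin t → Fin 3) (φ : CNF d) {ρ x : ℕ}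
    (hx : x < ((satLayout W φ).outWord ρ).length) :
    (satLayout W φ).out x ≤ 2 * ((satLayout W φ).outWord ρ).length := by
  have := (satLayout W φ).out_le x
  simp only [Layout.outWord, List.length_map, List.length_range] at hx ⊢
  omega

theorem size_le_self (n : ℕ) : Nat.size n ≤ n := Nat.size_le.2 Nat.lt_two_pow_self

theorem inputSize_le {w : List ℕ} {M : ℕ} (h : ∀ a ∈ w, a ≤ M) :
    inputSize w ≤ w.length * (M + 1) := by
  unfold inputSize
  refine (List.sum_le_card_nsmul _ (M + 1) ?_).trans (by simp)
  intro x hx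
  obtain ⟨a, ha, rfl⟩ := List.mem_map.1 hx
  exact Nat.succ_le_succ ((size_le_self a).trans (h a ha))

theorem inputSize_outWord_le (W : (Fin t₀ → Bool) → Fin t → Fin 3) (φ : CNF d) {ρ : ℕ}
    (hρ : ρ ≤ 1) : inputSize ((satLayout W φ).outWord ρ) ≤
      3 * (cellSize t₀ t + 2) ^ 4 * φ.bulk ^ 4 := by
  have h := length_outWord_le W φ hρ
  have h0 : 1 ≤ ((satLayout W φ).outWord ρ).length := by
    simp [Layout.outWord]
    omega
  refine (inputSize_le (M := 2 * ((satLayout W φ).outWord ρ).length) ?_).trans ?_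
  · intro a ha
    obtain ⟨x, hx, rfl⟩ := List.mem_map.1 ha
    exact out_le_length W φ (by simpa [Layout.outWord] using hx)
  · generalize ((satLayout W φ).outWord ρ).length = L at h h0
    calc L * (2 * L + 1) ≤ 3 * L ^ 2 := by nlinarith
      _ ≤ 3 * ((cellSize t₀ t + 2) ^ 2 * φ.bulk ^ 2) ^ 2 := by gcongr
      _ = _ := by ring

theorem exists_run_reduction (d : ℕ) (W : (Fin t₀ → Bool) → Fin t → Fin 3) {ρ : ℕ} (hρ : ρ ≤ 1) :
    ∃ R K : ℕ, ∀ φ : CNF d, ∃ s u, Run (reduction d W ρ) (initState φ.encode) s u ∧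
      (∀ y, R ≤ y → s.reg y = 0) ∧
      s.arr 2 = (fun i => ((satLayout W φ).outWord ρ).getD i 0) ∧
      (∀ a, 2 < a → s.arr a = fun _ => 0) ∧ u ≤ K * φ.bulk ^ 4 := by
  -- The expressions are kept opaque: for the time bound only their costs matter, which do not
  -- depend on the formula.
  obtain ⟨e₁, he₁⟩ : ∃ e : Expr, e = .read 0 (.const 1) := ⟨_, rfl⟩
  obtain ⟨e₂, he₂⟩ : ∃ e : Expr, e = .offset := ⟨_, rfl⟩
  obtain ⟨e₃, he₃⟩ : ∃ e : Expr, e = .outLength t₀ t ρ := ⟨_, rfl⟩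
  obtain ⟨e₄, he₄⟩ : ∃ e : Expr, e = .out d W := ⟨_, rfl⟩
  obtain ⟨B, hB⟩ : ∃ B, B = (cellSize t₀ t + 2) ^ 2 := ⟨_, rfl⟩
  refine ⟨(3 + e₂.width + e₁.width) + (3 + e₄.width + e₃.width),
    2 * ((e₂.cost + e₁.cost + 14) * (2 * B + 2)) +
    (B + 1) * ((e₄.cost + e₃.cost + 14) * (2 * B + 2)), fun φ => ?_⟩
  have hlen := length_outWord_le W φ hρ
  rw [← hB] at hlen
  have hbulk := φ.bulk_pos
  have hin : inputSize φ.encode + 1 ≤ φ.bulk := by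
    unfold CNF.bulk
    nlinarith
  have hm := φ.length_clauses_le
  have hsq : φ.bulk ≤ φ.bulk ^ 2 := by nlinarith
  -- `φ.bulk` dominates the input numbers and the offsets; the first summand dominates the output,
  -- whose entries are at most twice its length.
  obtain ⟨L, hL⟩ : ∃ L, L = 2 * (B * φ.bulk ^ 2) + φ.bulk := ⟨_, rfl⟩
  have hA : ∀ a i, Nat.size ((initState φ.encode).arr a i) ≤ L := by
    intro a i
    simp only [initState]
    split_ifs
    · exact (size_getD_le_inputSize _ _).trans (by omega)
    · simp
  have hoff : ∀ x < φ.clauses.length, Nat.size (φ.offset x) ≤ L := fun x hx =>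
    (size_le_self _).trans ((φ.offset_le hx.le).trans ((length_le_inputSize _).trans (by omega)))
  obtain ⟨s₁, t₁, r₁, a₁, u₁, b₁⟩ := exists_run_forStore (a := 1) (F := φ.offset)
    (n := φ.clauses.length) (L := L) (bound := e₁) (e := e₂) (initState φ.encode) hA hoff
    ((size_le_self _).trans (by omega))
    (by simp [he₁, initState, CNF.encode])
    (fun x hx => by
      rw [he₂]
      exact Expr.eval_offset φ (fun i => by simp [initState]) hx)
  have prep : ∀ A : ℕ → ℕ → ℕ, A 0 = s₁.arr 0 → A 1 = s₁.arr 1 → Expr.Prepared φ A := by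
    intro A h0 h1
    refine ⟨fun i => ?_, fun j hj => ?_⟩
    · rw [h0, a₁]; simp [fill, initState]
    · rw [h1, a₁]; simp [fill, hj]
  obtain ⟨s₂, t₂, r₂, a₂, u₂, b₂⟩ := exists_run_forStore (a := 2) (F := (satLayout W φ).out)
    (n := ((satLayout W φ).outWord ρ).length) (L := L) (bound := e₃) (e := e₄) s₁
    (by rw [a₁]; exact size_fill_le hA hoff le_rfl)
    (fun x hx => (size_le_self _).trans ((out_le_length W φ hx).trans (by omega)))
    ((size_le_self _).trans (by omega))
    (by rw [he₃]; exact Expr.eval_outLength W (prep _ rfl rfl))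
    (fun x hx => by rw [he₄]; exact Expr.eval_out (prep _ (by simp [fill]) (by simp [fill])))
  refine ⟨s₂, t₁ + t₂, ?_, ?_, ?_, ?_, ?_⟩
  · rw [he₁, he₂] at r₁
    rw [he₃, he₄] at r₂
    exact .seq r₁ r₂
  · intro y hy
    rw [u₂ y (by omega), u₁ y (by omega)]
    rfl
  · rw [a₂, a₁]
    funext i
    by_cases hi : i < ((satLayout W φ).outWord ρ).length
    · have hi' := hi
      simp only [Layout.outWord, List.length_map, List.length_range] at hi'
      simp only [fill, Function.update_self, hi, if_true]
      simp [Layout.outWord, List.getD_eq_getElem?_getD, hi']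
    · simp only [fill, Function.update_self, hi, if_false]
      rw [List.getD_eq_default _ _ (not_lt.1 hi)]
      simp [initState]
  · intro a ha
    rw [a₂, a₁]
    have h1 : a ≠ 1 := by omega
    have h2 : a ≠ 2 := by omega
    have h0 : a ≠ 0 := by omega
    funext i
    simp [fill, initState, h1, h2, h0]
  · have hL' : L + 1 ≤ (2 * B + 2) * φ.bulk ^ 2 := by
      rw [hL]
      nlinarith
    have hn : φ.clauses.length + 1 ≤ 2 * φ.bulk ^ 2 := by omega
    have hn' : ((satLayout W φ).outWord ρ).length + 1 ≤ (B + 1) * φ.bulk ^ 2 := by nlinarith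
    calc t₁ + t₂ ≤ 2 * φ.bulk ^ 2 * ((e₂.cost + e₁.cost + 14) * ((2 * B + 2) * φ.bulk ^ 2)) +
          (B + 1) * φ.bulk ^ 2 * ((e₄.cost + e₃.cost + 14) * ((2 * B + 2) * φ.bulk ^ 2)) :=
          Nat.add_le_add (b₁.trans (by gcongr)) (b₂.trans (by gcongr))
      _ = _ := by ring

open Filter Topology

/-! ### The choice of the parameters -/

/-- Since `t ^ 2 * (ρ / 3) ^ t` tends to 0, the polynomial loss from fixing a type is negligible for
large `t`. Then `t₀` is the rounded-down binary logarithm of `3 ^ t / (t + 1) ^ 2`. -/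
theorem exists_blocks {ρ : ℝ} (h1 : 1 ≤ ρ) (h3 : ρ < 3) :
    ∃ t t₀ : ℕ, 0 < t₀ ∧ 2 ^ t₀ * (t + 1) ^ 2 ≤ 3 ^ t ∧ ρ ^ t < 2 ^ t₀ := by
  have hlim := tendsto_pow_const_mul_const_pow_of_abs_lt_one (r := ρ / 3) 2
    (by rw [abs_of_nonneg (by positivity)]; linarith)
  -- The constant `1 / 8` pays 4 for `(t + 1) ^ 2 ≤ 4 * t ^ 2` and 2 for rounding the logarithm.
  obtain ⟨t, ht, ht1⟩ := ((hlim.eventually (gt_mem_nhds (show (0 : ℝ) < 1 / 8 by norm_num))).and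
    (eventually_ge_atTop 1)).exists
  have key : 2 * ((t : ℝ) + 1) ^ 2 * ρ ^ t ≤ 3 ^ t := by
    have h : (t : ℝ) ^ 2 * ρ ^ t < 1 / 8 * 3 ^ t := by
      rw [div_pow, ← mul_div_assoc, div_lt_iff₀ (by positivity)] at ht
      exact ht
    have ht1' : (1 : ℝ) ≤ t := by exact_mod_cast ht1
    have : ((t : ℝ) + 1) ^ 2 ≤ 4 * (t : ℝ) ^ 2 := by nlinarith
    nlinarith [pow_pos (show 0 < ρ by linarith) t]
  have hρ : 1 ≤ ρ ^ t := one_le_pow₀ h1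
  have hq : (t + 1) ^ 2 ≤ 3 ^ t := by
    have : ((t : ℝ) + 1) ^ 2 ≤ 3 ^ t := by nlinarith [sq_nonneg ((t : ℝ) + 1)]
    exact_mod_cast this
  have hpos : 0 < (t + 1) ^ 2 := by positivity
  have hq0 : 3 ^ t / (t + 1) ^ 2 ≠ 0 := (Nat.div_pos hq hpos).ne'
  have hlow := Nat.pow_log_le_self 2 hq0
  have hup := Nat.lt_pow_succ_log_self (b := 2) (by norm_num) (3 ^ t / (t + 1) ^ 2)
  generalize Nat.log 2 (3 ^ t / (t + 1) ^ 2) = t₀ at hlow hup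
  have hlt : ρ ^ t < 2 ^ t₀ := by
    have h : 3 ^ t < 2 ^ (t₀ + 1) * (t + 1) ^ 2 := (Nat.div_lt_iff_lt_mul hpos).1 hup
    have h : (3 : ℝ) ^ t < 2 ^ (t₀ + 1) * ((t : ℝ) + 1) ^ 2 := by exact_mod_cast h
    have h2 : 2 * ((t : ℝ) + 1) ^ 2 * ρ ^ t < 2 * ((t : ℝ) + 1) ^ 2 * 2 ^ t₀ := by
      refine key.trans_lt (h.trans_eq ?_)
      ring
    exact lt_of_mul_lt_mul_left h2 (by positivity)
  refine ⟨t, t₀, Nat.pos_of_ne_zero ?_, (Nat.le_div_iff_mul_le hpos).1 hlow, hlt⟩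
  rintro rfl
  simp at hlt
  linarith

theorem exists_base {θ : ℝ} {t₀ : ℕ} (h : θ < 2 ^ t₀) : ∃ σ : ℝ, 1 < σ ∧ σ < 2 ∧ θ < σ ^ t₀ := by
  have h1 : ∀ᶠ σ : ℝ in 𝓝[<] 2, θ < σ ^ t₀ :=
    nhdsWithin_le_nhds (((continuous_pow t₀).tendsto (2 : ℝ)).eventually (lt_mem_nhds h))
  have h2 : ∀ᶠ σ : ℝ in 𝓝[<] 2, σ ∈ Set.Ioo (1 : ℝ) 2 := Ioo_mem_nhdsLT (by norm_num)
  obtain ⟨σ, h, h'⟩ := (h1.and h2).exists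
  exact ⟨σ, h'.1, h'.2, h⟩

theorem exists_pow_mul_pow_le {θ γ : ℝ} (hθ : 0 < θ) (h : θ < γ) (e : ℕ) :
    ∃ D : ℝ, 0 ≤ D ∧ ∀ n : ℕ, ((n : ℝ) + 1) ^ e * θ ^ n ≤ D * γ ^ n := by
  have hγ : 0 < γ := hθ.trans h
  have hlim := tendsto_pow_const_mul_const_pow_of_abs_lt_one (r := θ / γ) e
    (by rw [abs_of_pos (by positivity), div_lt_one hγ]; exact h)
  obtain ⟨D, hD⟩ := hlim.bddAbove_range
  -- The sequence is used at `n + 1`; the factor `γ / θ` in the final constant undoes the shift.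
  have hD : ∀ n : ℕ, ((n : ℝ) + 1) ^ e * (θ / γ) ^ (n + 1) ≤ D := fun n => by
    simpa using hD ⟨n + 1, rfl⟩
  have hD0 : 0 ≤ D := le_trans (by positivity) (hD 0)
  refine ⟨D * (γ / θ), by positivity, fun n => ?_⟩
  have h' := mul_le_mul_of_nonneg_right (hD n) (show 0 ≤ γ / θ * γ ^ n by positivity)
  calc ((n : ℝ) + 1) ^ e * θ ^ n
      = ((n : ℝ) + 1) ^ e * (θ / γ) ^ (n + 1) * (γ / θ * γ ^ n) := by
        rw [div_pow]; field_simp; ring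
    _ ≤ _ := h'
    _ = _ := by ring

/-! ### The lower bound -/

/-- Every run takes positive time, so a nonpositive bound is never met. This settles the case `3 ≤
ε`. -/
theorem SolvableInTimeOStar.pos {P : DecisionProblem} {f : P.Instance → ℝ}
    (h : SolvableInTimeOStar P f) (x : P.Instance) : 0 < f x := by
  obtain ⟨p, C, c, hp⟩ := h
  obtain ⟨s, t, hr, -, ht⟩ := hp x
  have h0 : (0 : ℝ) < t := by exact_mod_cast hr.time_pos
  by_contra hf
  have : (C : ℝ) * (inputSize (P.encode x) : ℝ) ^ c * f x ≤ 0 :=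
    mul_nonpos_of_nonneg_of_nonpos (by positivity) (not_lt.1 hf)
  linarith

theorem CNF.one_le_inputSize {d : ℕ} (φ : CNF d) : 1 ≤ inputSize φ.encode := by
  simp [CNF.encode, inputSize]
  omega

/-- A fast algorithm for a problem to which `d`-SAT reduces by way of the gadget graph gives a
fast algorithm for `d`-SAT. -/
theorem solvable_dSAT {t₀ t d : ℕ} {W : (Fin t₀ → Bool) → Fin t → Fin 3} {τ : ℕ} (hτ : τ ≤ 1)
    {ρ σ : ℝ} (hρ : 1 ≤ ρ) (hσ : 1 < σ) (ht : 0 < t₀) (hlt : ρ ^ t < σ ^ t₀)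
    {Q : DecisionProblem} {f : Q.Instance → ℝ} (hQ : SolvableInTimeOStar Q f) {K : ℕ}
    (red : CNF d → Q.Instance) (hyes : ∀ φ, Q.Yes (red φ) ↔ φ.Satisfiable)
    (henc : ∀ φ, Q.encode (red φ) = (satLayout W φ).outWord τ)
    (hf : ∀ φ, f (red φ) ≤ ρ ^ (((satLayout W φ).G + 1) * t + K)) :
    SolvableInTimeOStar (dSAT d) fun φ : CNF d => σ ^ φ.numVars := by
  obtain ⟨p, C, c, hp⟩ := hQ
  obtain ⟨R, K₁, hred⟩ := exists_run_reduction d W hτ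
  obtain ⟨p', hp'⟩ := exists_run_of_reduction (P := dSAT d) (red := red) hyes
    (T := fun φ : CNF d => K₁ * φ.bulk ^ 4) (prog := reduction d W τ) (R := R) (K := 2)
    (fun φ : CNF d => by
      obtain ⟨s, u, h₁, h₂, h₃, h₄, h₅⟩ := hred φ
      exact ⟨s, u, h₁, h₂, by rw [h₃, henc], h₄, h₅⟩) p
  -- The exponent `4 * c + 4` covers both the reduction, of order `bulk ^ 4`, and the factor `(bulk
  -- ^ 4) ^ c` from the assumed algorithm.
  obtain ⟨D, hD0, hD⟩ := exists_pow_mul_pow_le (pow_pos (zero_lt_one.trans_le hρ) t) hlt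
    (4 * c + 4)
  obtain ⟨B, hB⟩ : ∃ B : ℕ, B = 3 * (cellSize t₀ t + 2) ^ 4 := ⟨_, rfl⟩
  obtain ⟨E, hE⟩ : ∃ E : ℝ, E = (K₁ + 1 + C * (B : ℝ) ^ c) * (2 * t₀) ^ (4 * c + 4) *
    ρ ^ (2 * t + K) * D := ⟨_, rfl⟩
  refine ⟨p', ⌈E⌉₊, 4 * c + 4, fun φ : CNF d => ?_⟩
  obtain ⟨s, u, hr, hs, hu⟩ := hp (red φ)
  obtain ⟨s', u', hr', hs', hu'⟩ := hp' φ s u hr hs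
  refine ⟨s', u', hr', hs', ?_⟩
  change (u' : ℝ) ≤ (⌈E⌉₊ : ℝ) * (inputSize φ.encode : ℝ) ^ (4 * c + 4) * σ ^ φ.numVars
  obtain ⟨h, hh⟩ : ∃ h, h = φ.numVars / t₀ := ⟨_, rfl⟩
  have hG : (satLayout W φ).G = h + 1 := by rw [hh]; rfl
  have hn : φ.numVars + 1 ≤ t₀ * (h + 1) := by
    have := Nat.lt_mul_div_succ φ.numVars ht
    rw [hh]; omega
  have hn' : t₀ * h ≤ φ.numVars := by rw [hh]; exact Nat.mul_div_le _ _
  have hx := φ.one_le_inputSize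
  obtain ⟨X, hX⟩ : ∃ X, X = inputSize φ.encode := ⟨_, rfl⟩
  obtain ⟨Y, hY⟩ : ∃ Y, Y = φ.bulk := ⟨_, rfl⟩
  have hYpos : 0 < Y := hY ▸ φ.bulk_pos
  -- The bulk splits into the input size `X` and a factor linear in the number of blocks. Powers of
  -- the latter are not polynomial in `X`; the gap between `ρ ^ t` and `σ ^ t₀` absorbs them through
  -- `hD`.
  have hYle : Y ≤ 2 * t₀ * (h + 1) * X := by
    rw [hY, hX, CNF.bulk]
    calc (φ.numVars + 1) * (inputSize φ.encode + 1)
        ≤ (t₀ * (h + 1)) * (2 * inputSize φ.encode) := by gcongr; omega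
      _ = _ := by ring
  have hsize : inputSize (Q.encode (red φ)) ≤ B * Y ^ 4 := by
    rw [henc, hB, hY]
    exact inputSize_outWord_le W φ hτ
  rw [← hY] at hu'
  rw [← hX]
  have hY1 : (1 : ℝ) ≤ Y := by exact_mod_cast hYpos
  have hYle' : (Y : ℝ) ≤ 2 * t₀ * (h + 1) * X := by exact_mod_cast hYle
  have hsize' : (inputSize (Q.encode (red φ)) : ℝ) ≤ B * (Y : ℝ) ^ 4 := by exact_mod_cast hsize
  have hu'' : (u' : ℝ) ≤ K₁ * (Y : ℝ) ^ 4 + 1 + u := by exact_mod_cast hu'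
  have hf' : f (red φ) ≤ ρ ^ (2 * t + K) * (ρ ^ t) ^ h := by
    refine (hf φ).trans_eq ?_
    rw [hG, ← pow_mul, ← pow_add]
    congr 1
    ring
  obtain ⟨M, hM⟩ : ∃ M, M = ρ ^ (2 * t + K) * (ρ ^ t) ^ h := ⟨_, rfl⟩
  have hM1 : 1 ≤ M := by
    rw [hM]
    exact one_le_mul_of_one_le_of_one_le (one_le_pow₀ hρ) (one_le_pow₀ (one_le_pow₀ hρ))
  rw [← hM] at hf'
  have hY4 : (Y : ℝ) ^ 4 ≤ (Y : ℝ) ^ (4 * c + 4) := pow_le_pow_right₀ hY1 (by omega)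
  have hYc : (1 : ℝ) ≤ (Y : ℝ) ^ (4 * c + 4) := one_le_pow₀ hY1
  have hu1 : (u : ℝ) ≤ C * (B : ℝ) ^ c * (Y : ℝ) ^ (4 * c + 4) * M := by
    calc (u : ℝ) ≤ C * (inputSize (Q.encode (red φ)) : ℝ) ^ c * f (red φ) := hu
      _ ≤ C * (inputSize (Q.encode (red φ)) : ℝ) ^ c * M := by gcongr
      _ ≤ C * (B * (Y : ℝ) ^ 4) ^ c * M := by gcongr
      _ = C * (B : ℝ) ^ c * (Y : ℝ) ^ (4 * c) * M := by ring
      _ ≤ C * (B : ℝ) ^ c * (Y : ℝ) ^ (4 * c + 4) * M := by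
        gcongr
        omega
  have h1 : (K₁ : ℝ) * (Y : ℝ) ^ 4 ≤ K₁ * (Y : ℝ) ^ (4 * c + 4) * M := by
    calc (K₁ : ℝ) * (Y : ℝ) ^ 4 ≤ K₁ * (Y : ℝ) ^ (4 * c + 4) := by gcongr
      _ ≤ _ := le_mul_of_one_le_right (by positivity) hM1
  have h2 : 1 ≤ (Y : ℝ) ^ (4 * c + 4) * M := one_le_mul_of_one_le_of_one_le hYc hM1
  have hγ : (σ ^ t₀) ^ h ≤ σ ^ φ.numVars := by
    rw [← pow_mul]
    exact pow_le_pow_right₀ hσ.le hn'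
  calc (u' : ℝ) ≤ (K₁ + 1 + C * (B : ℝ) ^ c) * ((Y : ℝ) ^ (4 * c + 4) * M) := by linarith
    _ ≤ (K₁ + 1 + C * (B : ℝ) ^ c) * ((2 * t₀ * (h + 1) * X) ^ (4 * c + 4) * M) := by gcongr
    _ = (K₁ + 1 + C * (B : ℝ) ^ c) * (2 * t₀) ^ (4 * c + 4) * ρ ^ (2 * t + K) *
        (X : ℝ) ^ (4 * c + 4) * (((h : ℝ) + 1) ^ (4 * c + 4) * (ρ ^ t) ^ h) := by
      rw [hM, mul_pow _ (X : ℝ), mul_pow _ ((h : ℝ) + 1)]; ring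
    _ ≤ (K₁ + 1 + C * (B : ℝ) ^ c) * (2 * t₀) ^ (4 * c + 4) * ρ ^ (2 * t + K) *
        (X : ℝ) ^ (4 * c + 4) * (D * (σ ^ t₀) ^ h) :=
      mul_le_mul_of_nonneg_left (hD h) (by positivity)
    _ = E * (X : ℝ) ^ (4 * c + 4) * (σ ^ t₀) ^ h := by rw [hE]; ring
    _ ≤ ⌈E⌉₊ * (X : ℝ) ^ (4 * c + 4) * σ ^ φ.numVars := by
      gcongr
      exact Nat.le_ceil E

/-- A fast algorithm for a problem with instances obtained from those of Steiner Tree, of running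
time at most exponential in the width of the arrangement, refutes the hypothesis. -/
theorem not_solvable (hSETH : SETH) {ρ : ℝ} (h1 : 1 ≤ ρ) (h3 : ρ < 3) {Q : DecisionProblem}
    {f : Q.Instance → ℝ} {τ : ℕ} (hτ : τ ≤ 1)
    (red : ∀ {t₀ t : ℕ}, Layout t₀ t → Q.Instance)
    (hyes : ∀ {t₀ t : ℕ} (Λ : Layout t₀ t), Q.Yes (red Λ) ↔ Λ.inst.HasSteinerTree)
    (henc : ∀ {t₀ t : ℕ} (Λ : Layout t₀ t), Q.encode (red Λ) = Λ.outWord τ)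
    (hf : ∀ {t₀ t : ℕ} (Λ : Layout t₀ t), f (red Λ) ≤
      ρ ^ arrangementCutwidth Λ.inst.graph (Equiv.refl (Fin Λ.inst.n))) :
    ¬ SolvableInTimeOStar Q f := by
  intro hQ
  obtain ⟨t, t₀, ht, hle, hlt⟩ := exists_blocks h1 h3
  obtain ⟨W, hW⟩ := exists_separated hle
  obtain ⟨σ, hσ1, hσ2, hσ⟩ := exists_base hlt
  -- The parameters `t`, `t₀`, `W` and `σ` depend on `ρ` only; `d` comes last and enters the width
  -- merely through the additive constant `K`.
  obtain ⟨d, hd⟩ := hSETH (2 - σ) (by linarith)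
  simp only [sub_sub_cancel] at hd
  refine hd (solvable_dSAT (W := W) hτ h1 hσ1 ht hσ hQ
    (K := cellSize t₀ t * cellSize t₀ t + 2 + d * 2 ^ t₀)
    (fun φ => red (satLayout W φ)) (fun φ => ?_) (fun φ => henc _) fun φ => ?_)
  · rw [hyes, Layout.hasSteinerTree_inst_iff hW (Nat.succ_pos _)]
    exact exists_hit_iff_satisfiable W φ ht
  · refine (hf _).trans (pow_le_pow_right₀ h1 ?_)
    obtain ⟨gr, hgr⟩ := exists_groups W φ
    refine (Layout.arrangementCutwidth_inst_le (Nat.succ_pos _) hgr).trans (le_of_eq ?_)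
    ring

/-! ### A single edge -/

/-- The instance whose graph is a single edge. -/
def edgeInst : ArrangedSTInstance where
  n := 2
  graph := ⊤
  terminals := ∅
  budget := 0
  arrangement := Equiv.refl _

theorem arrangementCutwidth_edge (ℓ : Fin 2 ≃ Fin 2) :
    arrangementCutwidth (⊤ : SimpleGraph (Fin 2)) ℓ = 1 := by
  have h0 : cut (⊤ : SimpleGraph (Fin 2)) ℓ 0 = {s(ℓ 0, ℓ 1)} := by
    ext e
    simp only [cut, Set.mem_ofPred_eq, Set.mem_singleton_iff]
    constructor
    · rintro ⟨-, j, k, hj, hk, rfl⟩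
      obtain rfl : j = 0 := by omega
      obtain rfl : k = 1 := by omega
      rfl
    · rintro rfl
      exact ⟨by simp, 0, 1, le_rfl, by simp, rfl⟩
  have h1 : cut (⊤ : SimpleGraph (Fin 2)) ℓ 1 = ∅ := by
    refine Set.eq_empty_of_forall_notMem ?_
    rintro e ⟨-, j, k, -, hk, -⟩
    omega
  simp [arrangementCutwidth, Fin.univ_succ, h0, h1]

theorem cutwidth_edge : cutwidth (⊤ : SimpleGraph (Fin 2)) = 1 := by
  simp [cutwidth, arrangementCutwidth_edge]

theorem cutwidth_le {n : ℕ} (G : SimpleGraph (Fin n)) (ℓ : Fin n ≃ Fin n) :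
    cutwidth G ≤ arrangementCutwidth G ℓ :=
  ciInf_le (OrderBot.bddBelow _) ℓ

end SteinerCutwidth

/-! ### The main theorem. -/

open SteinerCutwidth in
theorem mainTheorem6 (hSETH : SteinerCutwidth.SETH) (ε : ℝ) (hε : 0 < ε) :
    ¬ SteinerCutwidth.SolvableInTimeOStar SteinerCutwidth.steinerTree
        (fun I : SteinerCutwidth.STInstance => (3 - ε) ^ SteinerCutwidth.cutwidth I.graph) ∧
    ¬ SteinerCutwidth.SolvableInTimeOStar SteinerCutwidth.arrangedSteinerTree
        (fun I : SteinerCutwidth.ArrangedSTInstance =>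
          (3 - ε) ^ SteinerCutwidth.arrangementCutwidth I.graph I.arrangement) := by
  -- For `3 ≤ ε` the base is nonpositive, and an instance of width exactly 1 makes the claimed bound
  -- nonpositive.
  by_cases h3 : 3 ≤ ε
  · constructor
    · intro h
      have : (0 : ℝ) < (3 - ε) ^ cutwidth edgeInst.graph := h.pos edgeInst.toSTInstance
      rw [show cutwidth edgeInst.graph = 1 from cutwidth_edge, pow_one] at this
      linarith
    · intro h
      have : (0 : ℝ) < (3 - ε) ^ arrangementCutwidth edgeInst.graph edgeInst.arrangement :=
        h.pos edgeInst
      rw [show arrangementCutwidth edgeInst.graph edgeInst.arrangement = 1 from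
        arrangementCutwidth_edge _, pow_one] at this
      linarith
  · have h0 : 0 ≤ 3 - ε := by linarith
    -- Raising the base to at least 1 makes its powers monotone in the exponent, so upper bounds on
    -- the width can be inserted.
    have hm : 3 - ε ≤ max (3 - ε) 1 := le_max_left _ _
    have h1 : 1 ≤ max (3 - ε) 1 := le_max_right _ _
    have h3' : max (3 - ε) 1 < 3 := max_lt (by linarith) (by norm_num)
    constructor
    · refine not_solvable hSETH h1 h3' (Q := steinerTree) (τ := 0) (by norm_num)
        (fun Λ => Λ.inst) (fun _ => Iff.rfl) (fun Λ => Λ.outWord_zero.symm) fun Λ => ?_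
      exact (pow_le_pow_left₀ h0 hm _).trans (pow_le_pow_right₀ h1 (cutwidth_le _ _))
    · refine not_solvable hSETH h1 h3' (Q := arrangedSteinerTree) (τ := 1) le_rfl
        (fun Λ => Λ.arrangedInst) (fun _ => Iff.rfl) (fun Λ => Λ.outWord_one.symm) fun Λ => ?_
      exact pow_le_pow_left₀ h0 hm _
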